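/- Let $m_3\le m_2\le m_1$ be masses with $m_3\ge 0$, $m_1+m_2+m_3=1$ and $K:=m_2(m_3-m_2)+m_1(m_2+2m_3)\neq 0$ (this holds automatically when $m_3>0$). Put $M=\sqrt{m_2^2+m_2m_3+m_3^2}$ and let the primaries be located at $$(x_1,y_1)=\Big(\tfrac{-|K|\,M}{K},\,0\Big),\qquad (x_2,y_2)=\Big(\tfrac{|K|\,[(m_2-m_3)m_3+m_1(2m_2+m_3)]}{2KM},\ \tfrac{-\sqrt3\,m_3}{2m_2^{3/2}}\sqrt{\tfrac{m_2^3}{M^2}}\Big),\qquad (x_3,y_3)=\Big(\tfrac{|K|}{2M},\ \tfrac{\sqrt3}{2\sqrt{m_2}}\sqrt{\tfrac{m_2^3}{M^2}}\Big).$$ Let $\Omega(x,y)=\frac12(x^2+y^2)+\sum_{j=1}^3 m_j/r_j(x,y)$ with $r_j(x,y)=\sqrt{(x-x_j)^2+(y-y_j)^2}$ (the term with $m_j=0$, if any, is zero), and consider the vector field of the planar circular restricted four body problem (CRFBP) $$f(x,\dot x,y,\dot y)=\big(\dot x,\ 2\dot y+\Omega_x(x,y),\ \dot y,\ -2\dot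 x+\Omega_y(x,y)\big)$$ on $\mathbb R^4$ away from the positions of the primaries of positive mass. A libration point is a zero $L=(x_0,0,y_0,0)$ of $f$ in this domain; it is called critical if the linear map $Df(L)$ is not invertible. Below, all second derivatives of $\Omega$ are taken at $(x_0,y_0)$. For every libration point $L=(x_0,0,y_0,0)$, $f$ is differentiable at $L$, and: 1. the characteristic polynomial of $Df(L)$ is $\lambda^4+(4-\Omega_{xx}-\Omega_{yy})\lambda^2+\Omega_{xx}\Omega_{yy}-\Omega_{xy}^2$; 2. $Df(L)$ has eigenvalue $0$ if and only if $\Omega_{xx}\Omega_{yy}=\Omega_{xy}^2$; 3. if $L$ is critical, then the eigenvalue $0$ of $Df(L)$ has algebraic multiplicity $2$ and geometric multiplicity $1$; moreover $$v_0=(\Omega_{yy},\,0,\,-\Omega_{xy},\,0),\qquad v_1=(\Omega_{xy},\ \Omega_{yy},\ 2-\Omega_{xx},\ -\Omega_{xy})$$ are an eigenvector and a generalized eigenvector for the eigenvalue $0$: $v_0\ne 0$, $Df(L)v_0=0$ and $Df(L)v_1=v_0$. -/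

import Mathlib

open Polynomial

noncomputable section

namespace CRFBP

/-- The parameter simplex of mass triples: nonnegative, decreasingly ordered, total mass one. -/
def InSimplex (m₁ m₂ m₃ : ℝ) : Prop :=
  m₁ + m₂ + m₃ = 1 ∧ 0 ≤ m₃ ∧ m₃ ≤ m₂ ∧ m₂ ≤ m₁

/-- The constant `K` occurring in the formulas for the positions of the primaries. -/
def K (m₁ m₂ m₃ : ℝ) : ℝ := m₂ * (m₃ - m₂) + m₁ * (m₂ + 2 * m₃)

/-! Coordinates of the three primaries in the co-rotating frame. -/

def x₁ (m₁ m₂ m₃ : ℝ) : ℝ :=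
  -|K m₁ m₂ m₃| * √(m₂ ^ 2 + m₂ * m₃ + m₃ ^ 2) / K m₁ m₂ m₃

def y₁ (_m₁ _m₂ _m₃ : ℝ) : ℝ := 0

def x₂ (m₁ m₂ m₃ : ℝ) : ℝ :=
  |K m₁ m₂ m₃| * ((m₂ - m₃) * m₃ + m₁ * (2 * m₂ + m₃)) /
    (2 * K m₁ m₂ m₃ * √(m₂ ^ 2 + m₂ * m₃ + m₃ ^ 2))

def y₂ (_m₁ m₂ m₃ : ℝ) : ℝ :=
  -√3 * m₃ / (2 * m₂ ^ (3 / 2 : ℝ)) * √(m₂ ^ 3 / (m₂ ^ 2 + m₂ * m₃ + m₃ ^ 2))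

def x₃ (m₁ m₂ m₃ : ℝ) : ℝ :=
  |K m₁ m₂ m₃| / (2 * √(m₂ ^ 2 + m₂ * m₃ + m₃ ^ 2))

def y₃ (_m₁ m₂ m₃ : ℝ) : ℝ :=
  √3 / (2 * √m₂) * √(m₂ ^ 3 / (m₂ ^ 2 + m₂ * m₃ + m₃ ^ 2))

/-- Distance from `(x, y)` to `(a, b)`. -/
def dist2 (a b x y : ℝ) : ℝ := √((x - a) ^ 2 + (y - b) ^ 2)

def r₁ (m₁ m₂ m₃ x y : ℝ) : ℝ := dist2 (x₁ m₁ m₂ m₃) (y₁ m₁ m₂ m₃) x y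

def r₂ (m₁ m₂ m₃ x y : ℝ) : ℝ := dist2 (x₂ m₁ m₂ m₃) (y₂ m₁ m₂ m₃) x y

def r₃ (m₁ m₂ m₃ x y : ℝ) : ℝ := dist2 (x₃ m₁ m₂ m₃) (y₃ m₁ m₂ m₃) x y

/-- The effective potential `Ω`. -/
def Ω (m₁ m₂ m₃ x y : ℝ) : ℝ :=
  1 / 2 * (x ^ 2 + y ^ 2) + m₁ / r₁ m₁ m₂ m₃ x y + m₂ / r₂ m₁ m₂ m₃ x y + m₃ / r₃ m₁ m₂ m₃ x y

/-! First and second partial derivatives of `Ω`. -/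

def Ωx (m₁ m₂ m₃ x y : ℝ) : ℝ := deriv (fun s => Ω m₁ m₂ m₃ s y) x

def Ωy (m₁ m₂ m₃ x y : ℝ) : ℝ := deriv (fun s => Ω m₁ m₂ m₃ x s) y

def Ωxx (m₁ m₂ m₃ x y : ℝ) : ℝ := deriv (fun s => Ωx m₁ m₂ m₃ s y) x

def Ωxy (m₁ m₂ m₃ x y : ℝ) : ℝ := deriv (fun s => Ωx m₁ m₂ m₃ x s) y

def Ωyy (m₁ m₂ m₃ x y : ℝ) : ℝ := deriv (fun s => Ωy m₁ m₂ m₃ x s) y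

/-- The vector field of the CRFBP on states `(x, ẋ, y, ẏ)`. -/
def f (m₁ m₂ m₃ : ℝ) (u : Fin 4 → ℝ) : Fin 4 → ℝ :=
  ![u 1,
    2 * u 3 + Ωx m₁ m₂ m₃ (u 0) (u 2),
    u 3,
    -2 * u 1 + Ωy m₁ m₂ m₃ (u 0) (u 2)]

/-- Libration points: equilibria of the vector field, away from the collisions with the
primaries of positive mass (where the vector field is not defined). -/
def IsLibrationPoint (m₁ m₂ m₃ : ℝ) (L : Fin 4 → ℝ) : Prop :=
  (m₁ ≠ 0 → (L 0, L 2) ≠ (x₁ m₁ m₂ m₃, y₁ m₁ m₂ m₃)) ∧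
  (m₂ ≠ 0 → (L 0, L 2) ≠ (x₂ m₁ m₂ m₃, y₂ m₁ m₂ m₃)) ∧
  (m₃ ≠ 0 → (L 0, L 2) ≠ (x₃ m₁ m₂ m₃, y₃ m₁ m₂ m₃)) ∧
  f m₁ m₂ m₃ L = 0

/-- The linearization `Df(L)`, as an endomorphism of `ℝ⁴`. -/
def Df (m₁ m₂ m₃ : ℝ) (L : Fin 4 → ℝ) : Module.End ℝ (Fin 4 → ℝ) :=
  (fderiv ℝ (f m₁ m₂ m₃) L).toLinearMap

/-- Critical libration points: the linearization is not invertible. -/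
def IsCriticalLibrationPoint (m₁ m₂ m₃ : ℝ) (L : Fin 4 → ℝ) : Prop :=
  IsLibrationPoint m₁ m₂ m₃ L ∧ ¬ IsUnit (Df m₁ m₂ m₃ L)

def v₀ (m₁ m₂ m₃ x y : ℝ) : Fin 4 → ℝ :=
  ![Ωyy m₁ m₂ m₃ x y, 0, -Ωxy m₁ m₂ m₃ x y, 0]

def v₁ (m₁ m₂ m₃ x y : ℝ) : Fin 4 → ℝ :=
  ![Ωxy m₁ m₂ m₃ x y, Ωyy m₁ m₂ m₃ x y, 2 - Ωxx m₁ m₂ m₃ x y, -Ωxy m₁ m₂ m₃ x y]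

end CRFBP

end

/-!
Write `H` for the Hessian of `Ω` at the libration point, `d` for the vectors from the primaries to
it, `w = m / r ^ 3` for the weights and `s` for their sum, so that
`H = (1 - s) + 3 ∑ w (d / r) ⊗ (d / r)` has trace `2 + s`. The matrix of `Df(L)` is explicit, and
its characteristic polynomial is `λ⁴ + (4 - tr H) λ² + det H`. At a critical point `det H = 0`, and
all claims reduce to two facts: `tr H ≠ 4`, that is `s ≠ 2`, and `v₀ ≠ 0`, that is, `(0, 1)` is not
in the kernel of `H`.

The primaries form an equilateral triangle of side one with centre of mass at the origin. The
equilibrium equations `∑ (w - m) d = 0` therefore say that the numbers `b = T (1 - r ^ 3)`, with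
`T = w / (s - 1)`, are the barycentric coordinates of the point (`s ≤ 1` is impossible, by
`degenerateConfig_of_null`); and every `r ^ 2` is a quadratic polynomial in the `b`. Criticality
says that `1 / 3` is an eigenvalue of `N = ∑ T (d / r) ⊗ (d / r)`, in fact the smaller one. As
`T = b / (1 - r ^ 3)`, this is one condition on the position alone, which confines the point:

* it does not lie beyond a vertex of the triangle (`not_two_nonpos`), where `N` is too small in the
  direction orthogonal to that vertex;
* it does not lie beyond a side (`nonneg_of_pos_of_pos`), where `N - 1 / 3` is positive definite;
* inside the triangle every `b` exceeds `1 / 8` (`one_eighth_lt`), since otherwise `N` is too small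
  in the direction orthogonal to the nearest vertex.

In the remaining region `T < (1 + b) / 2`, so that `s / (s - 1) = ∑ T < 2` and `s > 2`: this gives
`tr H > 4`. Moreover, comparing the masses `m = w r ^ 3` there shows that the lightest primary, the
third, has the largest `b` (`max_of_mass_le`). Since `r ^ 2 (1 - r ^ 3) ≤ 1 / 3`, the matrix `N`
dominates three times the covariance matrix of the vertices with the weights `b`. The third
primary is the farthest from the axis, so the ordinates have variance above `1 / 9`, and a
vertical null vector is excluded (`not_null_vertical`).
-/

namespace CRFBP

open scoped Topology

/-! ### Degenerate configurations -/

/-- The normalised data of a critical libration point.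

`X i, Y i` are the coordinates of the libration point relative to the `i`-th vertex of an
equilateral triangle of side one, `r i` is its distance to that vertex, `T i` is the weight
`m i / r i ^ 3` divided by `s - 1`, where `s` is the sum of these weights, and
`b i = T i * (1 - r i ^ 3)`. The equilibrium equations say that the `b i` are the barycentric
coordinates of the libration point. The vector `(e₁, e₂)` is in the kernel of the Hessian of
the potential: it is an eigenvector, with eigenvalue `1 / 3`, of
`∑ i, T i / r i ^ 2 * (X i, Y i) ⊗ (X i, Y i)`. -/
structure DegenerateConfig (X Y b T r : Fin 3 → ℝ) (e₁ e₂ : ℝ) : Prop where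
  sum_b : ∑ i, b i = 1
  sum_bX : ∑ i, b i * X i = 0
  sum_bY : ∑ i, b i * Y i = 0
  side : ∀ i j, i ≠ j → (X i - X j) ^ 2 + (Y i - Y j) ^ 2 = 1
  r_pos : ∀ i, 0 < r i
  r_sq : ∀ i, r i ^ 2 = X i ^ 2 + Y i ^ 2
  T_nonneg : ∀ i, 0 ≤ T i
  T_mul : ∀ i, T i * (1 - r i ^ 3) = b i
  one_lt_sum : 1 < ∑ i, T i
  ne_zero : e₁ ≠ 0 ∨ e₂ ≠ 0
  null_x : ∑ i, T i / r i ^ 2 * (X i * e₁ + Y i * e₂) * X i = e₁ / 3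
  null_y : ∑ i, T i / r i ^ 2 * (X i * e₁ + Y i * e₂) * Y i = e₂ / 3

theorem exists_perm_fin_three : ∀ i j k : Fin 3, i ≠ j → i ≠ k → j ≠ k →
    ∃ σ : Equiv.Perm (Fin 3), σ 0 = i ∧ σ 1 = j ∧ σ 2 = k := by decide

theorem quadForm_pos {a b c x y : ℝ} (hdet : 0 < a * c - b ^ 2) (htr : 0 < a + c)
    (h : x ≠ 0 ∨ y ≠ 0) : 0 < a * x ^ 2 + 2 * b * x * y + c * y ^ 2 := by
  have ha : 0 < a := by
    by_contra! ha
    nlinarith [mul_nonneg (neg_nonneg.2 ha) htr.le, sq_nonneg a, sq_nonneg b]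
  have key : a * (a * x ^ 2 + 2 * b * x * y + c * y ^ 2) =
      (a * x + b * y) ^ 2 + (a * c - b ^ 2) * y ^ 2 := by ring
  refine pos_of_mul_pos_right (a := a) ?_ ha.le
  rw [key]
  by_cases hy : y = 0
  · have hx : x ≠ 0 := h.resolve_right (not_not.2 hy)
    subst hy
    have : 0 < (a * x) ^ 2 := by positivity
    simpa using this
  · have : 0 < y ^ 2 := by positivity
    nlinarith [mul_pos hdet this, sq_nonneg (a * x + b * y)]

/-- A singular symmetric `2 × 2` matrix of positive trace is positive semidefinite. -/
theorem quadForm_nonneg_of_null {a b c x y : ℝ} (h : x ≠ 0 ∨ y ≠ 0)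
    (h₁ : a * x + b * y = 0) (h₂ : b * x + c * y = 0) (htr : 0 < a + c) (u v : ℝ) :
    0 ≤ a * u ^ 2 + 2 * b * u * v + c * v ^ 2 := by
  have hn : 0 < x ^ 2 + y ^ 2 := by rcases h with h | h <;> positivity
  have key : (x ^ 2 + y ^ 2) * (a * u ^ 2 + 2 * b * u * v + c * v ^ 2) =
      (a + c) * (u * y - v * x) ^ 2 := by
    linear_combination (u ^ 2 * x - v ^ 2 * x + 2 * u * v * y) * h₁ +
      (v ^ 2 * y - u ^ 2 * y + 2 * u * v * x) * h₂
  refine nonneg_of_mul_nonneg_right (a := x ^ 2 + y ^ 2) ?_ hn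
  rw [key]; positivity

namespace DegenerateConfig

variable {X Y b T r : Fin 3 → ℝ} {e₁ e₂ : ℝ}

/-- The conditions are symmetric in the three vertices. -/
theorem perm (h : DegenerateConfig X Y b T r e₁ e₂) (σ : Equiv.Perm (Fin 3)) :
    DegenerateConfig (X ∘ σ) (Y ∘ σ) (b ∘ σ) (T ∘ σ) (r ∘ σ) e₁ e₂ where
  sum_b := (Equiv.sum_comp σ b).trans h.sum_b
  sum_bX := (Equiv.sum_comp σ fun i => b i * X i).trans h.sum_bX
  sum_bY := (Equiv.sum_comp σ fun i => b i * Y i).trans h.sum_bY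
  side _ _ hij := h.side _ _ (σ.injective.ne hij)
  r_pos _ := h.r_pos _
  r_sq _ := h.r_sq _
  T_nonneg _ := h.T_nonneg _
  T_mul _ := h.T_mul _
  one_lt_sum := h.one_lt_sum.trans_eq (Equiv.sum_comp σ T).symm
  ne_zero := h.ne_zero
  null_x := (Equiv.sum_comp σ fun i => T i / r i ^ 2 * (X i * e₁ + Y i * e₂) * X i).trans h.null_x
  null_y := (Equiv.sum_comp σ fun i => T i / r i ^ 2 * (X i * e₁ + Y i * e₂) * Y i).trans h.null_y

theorem sum_three (h : DegenerateConfig X Y b T r e₁ e₂) {i j k : Fin 3} (hij : i ≠ j)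
    (hik : i ≠ k) (hjk : j ≠ k) : b i + b j + b k = 1 := by
  obtain ⟨σ, rfl, rfl, rfl⟩ := exists_perm_fin_three i j k hij hik hjk
  simpa [Fin.sum_univ_three] using (h.perm σ).sum_b

/-- The squared distance to a vertex in barycentric coordinates. -/
theorem r_sq_eq (h : DegenerateConfig X Y b T r e₁ e₂) {i j k : Fin 3} (hij : i ≠ j)
    (hik : i ≠ k) (hjk : j ≠ k) : r i ^ 2 = b j ^ 2 + b j * b k + b k ^ 2 := by
  obtain ⟨σ, rfl, rfl, rfl⟩ := exists_perm_fin_three i j k hij hik hjk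
  replace h := h.perm σ
  have h0 := h.sum_b
  have h1 := h.sum_bX
  have h2 := h.sum_bY
  have s01 := h.side 0 1 (by decide)
  have s02 := h.side 0 2 (by decide)
  have s12 := h.side 1 2 (by decide)
  have hr := h.r_sq 0
  simp only [Fin.sum_univ_three, Function.comp] at *
  have hX : X (σ 0) = b (σ 1) * (X (σ 0) - X (σ 1)) + b (σ 2) * (X (σ 0) - X (σ 2)) := by
    linear_combination h1 - X (σ 0) * h0
  have hY : Y (σ 0) = b (σ 1) * (Y (σ 0) - Y (σ 1)) + b (σ 2) * (Y (σ 0) - Y (σ 2)) := by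
    linear_combination h2 - Y (σ 0) * h0
  rw [hr]
  rw [show X (σ 0) ^ 2 + Y (σ 0) ^ 2 =
      (b (σ 1) * (X (σ 0) - X (σ 1)) + b (σ 2) * (X (σ 0) - X (σ 2))) ^ 2 +
      (b (σ 1) * (Y (σ 0) - Y (σ 1)) + b (σ 2) * (Y (σ 0) - Y (σ 2))) ^ 2 by
    rw [← hX, ← hY]]
  linear_combination (b (σ 1) ^ 2 + b (σ 1) * b (σ 2)) * s01 +
    (b (σ 2) ^ 2 + b (σ 1) * b (σ 2)) * s02 - b (σ 1) * b (σ 2) * s12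

/-- The area of the triangle spanned by the point and two vertices is the third barycentric
coordinate times the area `√3 / 4` of the whole triangle. -/
theorem cross_sq (h : DegenerateConfig X Y b T r e₁ e₂) {i j k : Fin 3} (hij : i ≠ j)
    (hik : i ≠ k) (hjk : j ≠ k) : (X i * Y j - X j * Y i) ^ 2 = 3 / 4 * b k ^ 2 := by
  have hi := h.r_sq_eq hij hik hjk
  have hj := h.r_sq_eq hij.symm hjk hik
  have s := h.side i j hij
  have hs := h.sum_three hij hik hjk
  rw [h.r_sq] at hi hj
  have hdot : X i * X j + Y i * Y j = (r i ^ 2 + r j ^ 2 - 1) / 2 := by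
    rw [h.r_sq, h.r_sq]; linear_combination - s / 2
  have : (X i * Y j - X j * Y i) ^ 2 = r i ^ 2 * r j ^ 2 - ((r i ^ 2 + r j ^ 2 - 1) / 2) ^ 2 := by
    rw [← hdot, h.r_sq, h.r_sq]; ring
  rw [this, h.r_sq, h.r_sq, hi, hj, show b i = 1 - b j - b k by linarith]
  ring

/-- The eigenvalue `1 / 3` is the smaller one, because the trace `∑ i, T i` exceeds `1 > 2 / 3`. -/
theorem quadForm_nonneg (h : DegenerateConfig X Y b T r e₁ e₂) (u v : ℝ) :
    (u ^ 2 + v ^ 2) / 3 ≤ ∑ i, T i / r i ^ 2 * (X i * u + Y i * v) ^ 2 := by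
  have hx := h.null_x
  have hy := h.null_y
  have hT : ∀ i, T i = T i / r i ^ 2 * (X i ^ 2 + Y i ^ 2) := fun i => by
    rw [← h.r_sq]; have := (h.r_pos i).ne'; field_simp
  have htr := h.one_lt_sum
  simp only [Fin.sum_univ_three] at *
  set c₀ := T 0 / r 0 ^ 2
  set c₁ := T 1 / r 1 ^ 2
  set c₂ := T 2 / r 2 ^ 2
  rw [hT 0, hT 1, hT 2] at htr
  have := quadForm_nonneg_of_null (a := c₀ * X 0 ^ 2 + c₁ * X 1 ^ 2 + c₂ * X 2 ^ 2 - 1 / 3)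
    (b := c₀ * X 0 * Y 0 + c₁ * X 1 * Y 1 + c₂ * X 2 * Y 2)
    (c := c₀ * Y 0 ^ 2 + c₁ * Y 1 ^ 2 + c₂ * Y 2 ^ 2 - 1 / 3) h.ne_zero
    (by linear_combination hx) (by linear_combination hy) (by linarith) u v
  linarith

/-- The lower bound for the quadratic form, evaluated at the vector orthogonal to the direction of
the `i`-th vertex: that vertex does not contribute. -/
theorem radial_test (h : DegenerateConfig X Y b T r e₁ e₂) {i j k : Fin 3} (hij : i ≠ j)
    (hik : i ≠ k) (hjk : j ≠ k) :
    4 / 9 * r i ^ 2 ≤ T j / r j ^ 2 * b k ^ 2 + T k / r k ^ 2 * b j ^ 2 := by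
  have h1 := h.cross_sq hij hik hjk
  have h2 := h.cross_sq hik hij hjk.symm
  have hq : (Y i ^ 2 + (-X i) ^ 2) / 3 ≤ T i / r i ^ 2 * (X i * Y i + Y i * (-X i)) ^ 2 +
      T j / r j ^ 2 * (X j * Y i + Y j * (-X i)) ^ 2 +
      T k / r k ^ 2 * (X k * Y i + Y k * (-X i)) ^ 2 := by
    obtain ⟨σ, rfl, rfl, rfl⟩ := exists_perm_fin_three i j k hij hik hjk
    simpa [Fin.sum_univ_three] using (h.perm σ).quadForm_nonneg (Y (σ 0)) (-X (σ 0))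
  rw [show X j * Y i + Y j * (-X i) = -(X i * Y j - X j * Y i) by ring,
    show X k * Y i + Y k * (-X i) = -(X i * Y k - X k * Y i) by ring, neg_sq (X i * Y j - _),
    neg_sq (X i * Y k - _), h1, h2] at hq
  rw [h.r_sq i]
  linarith

end DegenerateConfig

/-! ### Position inside the triangle -/

/-- The numerator of a determinant, grouped into its homogeneous parts of degree `4`, `5` and `6`,
each of which is positive on the sector considered. -/
theorem lens_poly_pos {β σ : ℝ} (hβ : 0 < β) (hσ : -β < σ) :
    0 < (28 * σ ^ 4 - 46 * β * σ ^ 3 + 54 * β ^ 2 * σ ^ 2 - 32 * β ^ 3 * σ + 20 * β ^ 4) +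
      (35 * σ ^ 5 + 24 * β * σ ^ 4 - 38 * β ^ 2 * σ ^ 3 + 44 * β ^ 3 * σ ^ 2 - 24 * β ^ 4 * σ +
        40 * β ^ 5) +
      (7 * σ ^ 6 + 4 * β * σ ^ 5 - 4 * β ^ 2 * σ ^ 4 - 24 * β ^ 3 * σ ^ 3 + 10 * β ^ 4 * σ ^ 2 +
        8 * β ^ 5 * σ + 20 * β ^ 6) := by
  have h4 : 0 < 28 * σ ^ 4 - 46 * β * σ ^ 3 + 54 * β ^ 2 * σ ^ 2 - 32 * β ^ 3 * σ + 20 * β ^ 4 := by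
    nlinarith [sq_nonneg (σ ^ 2 - β * σ), sq_nonneg (β * σ - β ^ 2),
      sq_nonneg (σ ^ 2 - β * σ * (23 / 28)), sq_nonneg (β * σ),
      pow_pos hβ 4, sq_nonneg (σ ^ 2), sq_nonneg (β * σ - β ^ 2 * (1 / 2))]
  have h5 : 0 < 35 * σ ^ 5 + 24 * β * σ ^ 4 - 38 * β ^ 2 * σ ^ 3 + 44 * β ^ 3 * σ ^ 2 -
      24 * β ^ 4 * σ + 40 * β ^ 5 := by
    have ht : 0 < σ + β := by linarith
    nlinarith [mul_nonneg ht.le (sq_nonneg (σ ^ 2 - β * σ)),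
      mul_nonneg ht.le (sq_nonneg (β * σ - β ^ 2)),
      mul_nonneg hβ.le (sq_nonneg (σ ^ 2 - β * σ)), mul_nonneg hβ.le (sq_nonneg (β * σ - β ^ 2)),
      mul_nonneg ht.le (sq_nonneg (σ ^ 2)), mul_nonneg ht.le (sq_nonneg (β * σ)),
      mul_nonneg hβ.le (sq_nonneg (σ ^ 2)), mul_nonneg hβ.le (sq_nonneg (β * σ)),
      pow_pos hβ 5, mul_pos ht (pow_pos hβ 4),
      mul_nonneg ht.le (sq_nonneg (σ ^ 2 - β ^ 2)), mul_nonneg hβ.le (sq_nonneg (σ ^ 2 - β ^ 2))]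
  have h6 : 0 < 7 * σ ^ 6 + 4 * β * σ ^ 5 - 4 * β ^ 2 * σ ^ 4 - 24 * β ^ 3 * σ ^ 3 +
      10 * β ^ 4 * σ ^ 2 + 8 * β ^ 5 * σ + 20 * β ^ 6 := by
    have ht : 0 < σ + β := by linarith
    have hβt := mul_pos hβ ht
    nlinarith [sq_nonneg (σ ^ 3 - β ^ 2 * σ), sq_nonneg (σ ^ 3 - β ^ 3),
      sq_nonneg (β * σ ^ 2 - β ^ 3), sq_nonneg (β ^ 2 * σ - β ^ 3),
      sq_nonneg (σ ^ 3 - β * σ ^ 2), sq_nonneg (β * σ ^ 2 - β ^ 2 * σ),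
      pow_pos hβ 6, mul_nonneg hβt.le (sq_nonneg (σ ^ 2 - β ^ 2)),
      mul_nonneg hβt.le (sq_nonneg (σ ^ 2 - β * σ)), mul_nonneg hβt.le (sq_nonneg (β * σ - β ^ 2)),
      mul_nonneg hβt.le (sq_nonneg (σ ^ 2)), mul_nonneg hβt.le (sq_nonneg (β * σ)),
      mul_pos hβt (pow_pos hβ 4)]
  linarith

theorem one_sub_cube_le {r : ℝ} (hr : 0 ≤ r) : 1 - r ^ 3 ≤ 3 / 2 * (1 - r ^ 2) := by
  linarith [mul_nonneg (sq_nonneg (r - 1)) (by linarith : 0 ≤ r + 1 / 2)]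

/-- The range `r ^ 2 ≤ 3` covers the points beyond one side and within distance one of its two
endpoints. -/
theorem cube_sub_one_le {r : ℝ} (h1 : 1 ≤ r) (h3 : r ^ 2 ≤ 3) :
    r ^ 3 - 1 ≤ 21 / 10 * (r ^ 2 - 1) := by
  have hr : r ^ 2 - 11 / 10 * r - 11 / 10 ≤ 0 := by nlinarith
  linarith [mul_nonpos_of_nonneg_of_nonpos (sub_nonneg.2 h1) hr]

namespace DegenerateConfig

variable {X Y b T r : Fin 3 → ℝ} {e₁ e₂ : ℝ}

/-- The libration point does not lie in the closed sector beyond the vertex `k`. There the weights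
of the two far vertices are too small for the test direction orthogonal to vertex `k`. -/
theorem not_two_nonpos (h : DegenerateConfig X Y b T r e₁ e₂) {i j k : Fin 3} (hij : i ≠ j)
    (hik : i ≠ k) (hjk : j ≠ k) (hi : b i ≤ 0) : 0 < b j := by
  by_contra! hj
  have ht := h.radial_test hik.symm hjk.symm hij
  have hs := h.sum_three hij hik hjk
  have hRk := h.r_sq_eq hik.symm hjk.symm hij
  have hRi := h.r_sq_eq hij hik hjk
  have hRj := h.r_sq_eq hij.symm hjk hik
  -- With `b i = -β`, `b j = -γ` one has `r i ^ 2 ≥ 1 + 2β + γ` and `r j ^ 2 ≥ 1 + 2γ + β`, and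
  -- the test forces `β = γ` and `T i = 0`.
  obtain ⟨β, hβ⟩ : ∃ β, b i = -β := ⟨-b i, by ring⟩
  obtain ⟨γ, hγ⟩ : ∃ γ, b j = -γ := ⟨-b j, by ring⟩
  have hk : b k = 1 + β + γ := by linarith
  rw [hβ] at hi ht hRj hRk
  rw [hγ] at hj ht hRi hRk
  rw [hk] at hRi hRj
  have hβ0 : 0 ≤ β := by linarith
  have hγ0 : 0 ≤ γ := by linarith
  have bound : ∀ l : Fin 3, ∀ c : ℝ, 0 ≤ c → 1 + c ≤ r l ^ 2 → T l * c * (3 / 2) ≤ -b l := by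
    intro l c hc hr
    have h1 : 1 ≤ r l := by nlinarith [h.r_pos l]
    rw [← h.T_mul l]
    have : 3 / 2 * c ≤ r l ^ 3 - 1 := by
      linarith [one_sub_cube_le (h.r_pos l).le]
    linarith [mul_le_mul_of_nonneg_left this (h.T_nonneg l)]
  have hTi := bound i (2 * β + γ) (by positivity) (by rw [hRi]; nlinarith [mul_nonneg hβ0 hγ0])
  have hTj := bound j (2 * γ + β) (by positivity) (by rw [hRj]; nlinarith [mul_nonneg hβ0 hγ0])
  have div_le : ∀ l : Fin 3, 1 ≤ r l ^ 2 → T l / r l ^ 2 ≤ T l := fun l hl =>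
    div_le_self (h.T_nonneg l) hl
  have h1 := mul_le_mul_of_nonneg_right
    (div_le i (by rw [hRi]; nlinarith [mul_nonneg hβ0 hγ0])) (sq_nonneg γ)
  have h2 := mul_le_mul_of_nonneg_right
    (div_le j (by rw [hRj]; nlinarith [mul_nonneg hβ0 hγ0])) (sq_nonneg β)
  have hTi0 := h.T_nonneg i
  have hTj0 := h.T_nonneg j
  have hRk0 : 0 < r k ^ 2 := by have := h.r_pos k; positivity
  rw [hRk] at hRk0 ht
  rw [hβ] at hTi
  rw [hγ] at hTj
  have key : 4 / 9 * (β - γ) ^ 2 + 2 * (T i + T j) * (β * γ) ≤ 0 := by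
    linarith [mul_le_mul_of_nonneg_right hTi hγ0, mul_le_mul_of_nonneg_right hTj hβ0]
  have hpos : 0 ≤ 2 * (T i + T j) * (β * γ) := by positivity
  have hβγ : β = γ := by
    have : (β - γ) ^ 2 = 0 := le_antisymm (by linarith) (sq_nonneg _)
    linarith [pow_eq_zero_iff two_ne_zero |>.1 this]
  have hzero : (T i + T j) * (β * γ) = 0 := by
    nlinarith [sq_nonneg (β - γ)]
  subst hβγ
  have hβne : β ≠ 0 := by
    rintro rfl
    simp at hRk0
  have hT0 : T i = 0 := by
    have : T i + T j = 0 := (mul_eq_zero.1 hzero).resolve_right (mul_ne_zero hβne hβne)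
    linarith
  have := h.T_mul i
  rw [hT0, hβ] at this
  exact hβne (by linarith)

/-- The quadratic form takes the value `|e|² / 3` at the null vector `e`. -/
theorem null_quad (h : DegenerateConfig X Y b T r e₁ e₂) {i j k : Fin 3} (hij : i ≠ j)
    (hik : i ≠ k) (hjk : j ≠ k) :
    T i / r i ^ 2 * (X i * e₁ + Y i * e₂) ^ 2 + T j / r j ^ 2 * (X j * e₁ + Y j * e₂) ^ 2 +
      T k / r k ^ 2 * (X k * e₁ + Y k * e₂) ^ 2 = (e₁ ^ 2 + e₂ ^ 2) / 3 := by
  obtain ⟨σ, rfl, rfl, rfl⟩ := exists_perm_fin_three i j k hij hik hjk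
  have hx := (h.perm σ).null_x
  have hy := (h.perm σ).null_y
  simp only [Fin.sum_univ_three, Function.comp] at hx hy
  linear_combination e₁ * hx + e₂ * hy

theorem r_lt_one (h : DegenerateConfig X Y b T r e₁ e₂) {i : Fin 3} (hi : 0 < b i) :
    r i < 1 := by
  by_contra! h1
  have : 1 ≤ r i ^ 3 := one_le_pow₀ h1
  nlinarith [h.T_mul i, h.T_nonneg i]

theorem one_lt_r (h : DegenerateConfig X Y b T r e₁ e₂) {i : Fin 3} (hi : b i < 0) :
    1 < r i := by
  by_contra! h1
  have : r i ^ 3 ≤ 1 := pow_le_one₀ (h.r_pos i).le h1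
  nlinarith [h.T_mul i, h.T_nonneg i]

/-- The libration point does not lie beyond the side opposite to the vertex `i`.

It would have distance more than one from that vertex and less than one from the other two. Lower
bounds for the three weights then give a matrix all of whose eigenvalues exceed `1 / 3`. -/
theorem nonneg_of_pos_of_pos (h : DegenerateConfig X Y b T r e₁ e₂) {i j k : Fin 3} (hij : i ≠ j)
    (hik : i ≠ k) (hjk : j ≠ k) (hj : 0 < b j) (hk : 0 < b k) : 0 ≤ b i := by
  by_contra! hi
  have hs := h.sum_three hij hik hjk
  have hRi := h.r_sq_eq hij hik hjk
  have hRj := h.r_sq_eq hij.symm hjk hik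
  have hRk := h.r_sq_eq hik.symm hjk.symm hij
  have cij := h.cross_sq hij hik hjk
  have cik := h.cross_sq hik hij hjk.symm
  have cjk := h.cross_sq hjk hij.symm hik.symm
  have hq := h.null_quad hij hik hjk
  have hri := h.one_lt_r hi
  have hrj := h.r_lt_one hj
  have hrk := h.r_lt_one hk
  have hTi := h.T_mul i
  have hTj := h.T_mul j
  have hTk := h.T_mul k
  have hrj0 := h.r_pos j
  have hrk0 := h.r_pos k
  obtain ⟨β, hβ⟩ : ∃ β, b i = -β := ⟨-b i, by ring⟩
  obtain ⟨y, hy⟩ : ∃ y, b j = y := ⟨_, rfl⟩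
  obtain ⟨z, hz⟩ : ∃ z, b k = z := ⟨_, rfl⟩
  rw [hβ] at hi hRj hRk cjk hTi hs
  rw [hy] at hj hRi hRk cik hTj hs
  rw [hz] at hk hRi hRj cij hTk hs
  have hβ0 : 0 < β := by linarith
  -- `σ` is the power of the point with respect to the circumcircle, so that every
  -- `1 - r ^ 2` is the barycentric coordinate minus `σ`.
  obtain ⟨σ, hσ⟩ : ∃ σ, σ = β + β ^ 2 - y * z := ⟨_, rfl⟩
  have hβyz : β = y + z - 1 := by linarith
  have hRi' : r i ^ 2 = 1 + (β + σ) := by rw [hRi, hσ, hβyz]; ring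
  have hRj' : r j ^ 2 = 1 - (y - σ) := by rw [hRj, hσ, hβyz]; ring
  have hRk' : r k ^ 2 = 1 - (z - σ) := by rw [hRk, hσ, hβyz]; ring
  have hDi : 0 < β + σ := by
    linarith [one_lt_pow₀ hri two_ne_zero]
  have hDj : 0 < y - σ := by
    linarith [pow_lt_one₀ hrj0.le hrj two_ne_zero]
  have hDk : 0 < z - σ := by
    linarith [pow_lt_one₀ hrk0.le hrk two_ne_zero]
  have hRi3 : r i ^ 2 ≤ 3 := by
    have hsum : y ^ 2 + z ^ 2 < 2 + β - β ^ 2 := by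
      have e : (y - σ) + (z - σ) = 2 + β - β ^ 2 - (y ^ 2 + z ^ 2) := by
        rw [hσ, hβyz]; ring
      linarith
    have hβ1 : β < 1 := by
      by_contra! h1
      rw [hβyz] at h1 hsum
      linarith [sq_nonneg (y - z), mul_nonneg (sub_nonneg.2 h1) (by linarith : 0 ≤ y + z)]
    rw [hRi]
    have : y ^ 2 + y * z + z ^ 2 = ((1 + β) ^ 2 + (y ^ 2 + z ^ 2)) / 2 := by rw [hβyz]; ring
    linarith
  -- Replacing `1 - r ^ 3` by multiples of `1 - r ^ 2` makes the lower bounds for the weights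
  -- rational in the barycentric coordinates; `10 / 21` comes from `cube_sub_one_le`.
  have bi : 10 / 21 * β / (β + σ) ≤ T i := by
    rw [div_le_iff₀ hDi]
    have := cube_sub_one_le hri.le hRi3
    rw [hRi'] at this
    linarith [mul_le_mul_of_nonneg_left this (h.T_nonneg i)]
  have bj : 2 / 3 * y / (y - σ) ≤ T j := by
    rw [div_le_iff₀ hDj]
    have := one_sub_cube_le hrj0.le
    rw [hRj'] at this
    linarith [mul_le_mul_of_nonneg_left this (h.T_nonneg j)]
  have bk : 2 / 3 * z / (z - σ) ≤ T k := by
    rw [div_le_iff₀ hDk]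
    have := one_sub_cube_le hrk0.le
    rw [hRk'] at this
    linarith [mul_le_mul_of_nonneg_left this (h.T_nonneg k)]
  have hRi0 : 0 < 1 + (β + σ) := by linarith
  have hRj0 : 0 < 1 - (y - σ) := by rw [← hRj']; positivity
  have hRk0 : 0 < 1 - (z - σ) := by rw [← hRk']; positivity
  obtain ⟨ci, hci⟩ : ∃ ci, ci = 10 / 21 * β / (β + σ) / (1 + (β + σ)) := ⟨_, rfl⟩
  obtain ⟨cj, hcj⟩ : ∃ cj, cj = 2 / 3 * y / (y - σ) / (1 - (y - σ)) := ⟨_, rfl⟩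
  obtain ⟨ck, hck⟩ : ∃ ck, ck = 2 / 3 * z / (z - σ) / (1 - (z - σ)) := ⟨_, rfl⟩
  have hXi := h.r_sq i
  have hXj := h.r_sq j
  have hXk := h.r_sq k
  have htr : 2 / 3 < ci * r i ^ 2 + cj * r j ^ 2 + ck * r k ^ 2 := by
    have hyz : σ ^ 2 < y * z := by
      rcases le_or_gt 0 σ with h0 | h0
      · linarith [mul_pos hDj hDk, mul_nonneg h0 hDj.le, mul_nonneg h0 hDk.le]
      · linarith [mul_pos (by linarith : 0 < β - σ) hDi]
    rw [hci, hcj, hck, hRi', hRj', hRk', div_mul_cancel₀ _ hRi0.ne', div_mul_cancel₀ _ hRj0.ne',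
      div_mul_cancel₀ _ hRk0.ne']
    have h1 : 0 < 10 / 21 * β / (β + σ) := by positivity
    have h2 : 2 / 3 * y / (y - σ) + 2 / 3 * z / (z - σ) - 2 / 3 =
        2 / 3 * (y * z - σ ^ 2) / ((y - σ) * (z - σ)) := by
      field_simp; ring
    have h3 : 0 < 2 / 3 * (y * z - σ ^ 2) / ((y - σ) * (z - σ)) := by
      have : 0 < y * z - σ ^ 2 := by linarith
      positivity
    linarith
  -- The determinant of the comparison matrix minus `1 / 3`: it depends on `y, z` only through
  -- `β` and `σ`, up to positive factors.
  have hdet : 0 < ci * cj * (3 / 4 * z ^ 2) + ci * ck * (3 / 4 * y ^ 2) +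
      cj * ck * (3 / 4 * (-β) ^ 2) - (ci * r i ^ 2 + cj * r j ^ 2 + ck * r k ^ 2) / 3 + 1 / 9 := by
    have hP := lens_poly_pos hβ0 (by linarith : -β < σ)
    have : ci * cj * (3 / 4 * z ^ 2) + ci * ck * (3 / 4 * y ^ 2) +
      cj * ck * (3 / 4 * (-β) ^ 2) - (ci * r i ^ 2 + cj * r j ^ 2 + ck * r k ^ 2) / 3 + 1 / 9 =
      ((28 * σ ^ 4 - 46 * β * σ ^ 3 + 54 * β ^ 2 * σ ^ 2 - 32 * β ^ 3 * σ + 20 * β ^ 4) +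
      (35 * σ ^ 5 + 24 * β * σ ^ 4 - 38 * β ^ 2 * σ ^ 3 + 44 * β ^ 3 * σ ^ 2 - 24 * β ^ 4 * σ +
        40 * β ^ 5) +
      (7 * σ ^ 6 + 4 * β * σ ^ 5 - 4 * β ^ 2 * σ ^ 4 - 24 * β ^ 3 * σ ^ 3 + 10 * β ^ 4 * σ ^ 2 +
        8 * β ^ 5 * σ + 20 * β ^ 6)) / (63 * ((β + σ) * (y - σ) * (z - σ)) *
        ((1 + (β + σ)) * (1 - (y - σ)) * (1 - (z - σ)))) := by
      rw [hRi', hRj', hRk', hci, hcj, hck, eq_div_iff (by positivity)]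
      field_simp
      subst hσ hβyz
      ring
    rw [this]
    positivity
  have hform := quadForm_pos (a := ci * X i ^ 2 + cj * X j ^ 2 + ck * X k ^ 2 - 1 / 3)
    (b := ci * X i * Y i + cj * X j * Y j + ck * X k * Y k)
    (c := ci * Y i ^ 2 + cj * Y j ^ 2 + ck * Y k ^ 2 - 1 / 3) (x := e₁) (y := e₂)
    (by rw [← cij, ← cik, ← cjk, hXi, hXj, hXk] at hdet
        linear_combination hdet)
    (by rw [hXi, hXj, hXk] at htr; linarith) h.ne_zero
  have mono : ∀ (l : Fin 3) (c D R : ℝ), 0 < R → r l ^ 2 = R → D ≤ T l → c = D / R →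
      c * (X l * e₁ + Y l * e₂) ^ 2 ≤ T l / r l ^ 2 * (X l * e₁ + Y l * e₂) ^ 2 := by
    rintro l c D R hR hr hD rfl
    rw [hr]
    gcongr
  have m1 := mono i _ _ _ hRi0 hRi' bi hci
  have m2 := mono j _ _ _ hRj0 hRj' bj hcj
  have m3 := mono k _ _ _ hRk0 hRk' bk hck
  linarith

/-- The libration point lies in the closed triangle of the primaries. -/
theorem b_nonneg (h : DegenerateConfig X Y b T r e₁ e₂) (i : Fin 3) : 0 ≤ b i := by
  obtain ⟨j, k, hij, hik, hjk⟩ : ∃ j k : Fin 3, i ≠ j ∧ i ≠ k ∧ j ≠ k := by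
    revert i; decide
  by_contra! hi
  exact hi.not_ge (h.nonneg_of_pos_of_pos hij hik hjk (h.not_two_nonpos hij hik hjk hi.le)
    (h.not_two_nonpos hik hij hjk.symm hi.le))

end DegenerateConfig

/-! ### The trace and the null direction -/

theorem sq_mul_one_sub_cube_le {r : ℝ} (hr : 0 ≤ r) : r ^ 2 * (1 - r ^ 3) ≤ 1 / 3 := by
  -- The maximum is attained where `r ^ 3 = 2 / 5`, close to `r = 37 / 50`, `r ^ 2 = 27 / 50`.
  nlinarith [mul_nonneg hr (sq_nonneg (r ^ 2 - 27 / 50)), mul_nonneg hr (sq_nonneg (r - 37 / 50)),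
    sq_nonneg (r - 37 / 50)]

theorem half_one_sub_sq_mul_le (r : ℝ) : (1 - r ^ 2) * (2 + r ^ 2) / 2 ≤ 1 - r ^ 3 := by
  linarith [mul_nonneg (sq_nonneg r) (sq_nonneg (1 - r))]

/-- The homogenised inequality of `interior_poly_le` on the triangle of points `(y, z)` with
vertices `(0, 0)`, `(1/2, 0)`, `(7/16, 1/8)`. In barycentric coordinates `A, B, C` of that triangle
all its coefficients are nonnegative. -/
theorem interior_poly_wedge₁ {A B C y z x p : ℝ} (hA : 0 ≤ A) (hB : 0 ≤ B) (hC : 0 ≤ C)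
    (hy : y = B / 2 + 7 * C / 16) (hz : z = C / 8) (hx : x = A + B + C - y - z)
    (hp : p = x * y + x * z + y * z) :
    0 ≤ 13 / 30 * ((y ^ 2 + y * z + z ^ 2) * (x ^ 2 + x * z + z ^ 2) * (x ^ 2 + x * y + y ^ 2) *
      (y * (A + B + C) + p) * (z * (A + B + C) + p)) -
      y * z * (8 / 9 * (z * (x ^ 2 + x * y + y ^ 2) * (z * (A + B + C) + p)) +
        7 / 9 * (y * (x ^ 2 + x * z + z ^ 2) * (y * (A + B + C) + p))) * (A + B + C) ^ 3 := by
  subst hp hx hy hz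
  ring_nf
  positivity

/-- The analogue of `interior_poly_wedge₁` on the triangle with vertices `(0, 0)`, `(7/16, 1/8)`,
`(1/8, 1/8)`. -/
theorem interior_poly_wedge₂ {A B C y z x p : ℝ} (hA : 0 ≤ A) (hB : 0 ≤ B) (hC : 0 ≤ C)
    (hy : y = 7 * B / 16 + C / 8) (hz : z = B / 8 + C / 8) (hx : x = A + B + C - y - z)
    (hp : p = x * y + x * z + y * z) :
    0 ≤ 13 / 30 * ((y ^ 2 + y * z + z ^ 2) * (x ^ 2 + x * z + z ^ 2) * (x ^ 2 + x * y + y ^ 2) *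
      (y * (A + B + C) + p) * (z * (A + B + C) + p)) -
      y * z * (8 / 9 * (z * (x ^ 2 + x * y + y ^ 2) * (z * (A + B + C) + p)) +
        7 / 9 * (y * (x ^ 2 + x * z + z ^ 2) * (y * (A + B + C) + p))) * (A + B + C) ^ 3 := by
  subst hp hx hy hz
  ring_nf
  positivity

/-- The polynomial inequality that contradicts `radial_test` when the smallest barycentric
coordinate `z` is at most `1 / 8`. The constants `8 / 9` and `7 / 9` bound the weights, and
`13 / 30` is a number slightly below the `4 / 9` of the test. The region `z ≤ y ≤ x`, `z ≤ 1 / 8` is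
the union of two triangles. -/
theorem interior_poly_le {x y z p : ℝ} (hx : x = 1 - y - z) (hp : p = x * y + x * z + y * z)
    (hz : 0 ≤ z) (hzy : z ≤ y) (hyx : y ≤ x) (hz8 : z ≤ 1 / 8) :
    y * z * (8 / 9 * (z * (x ^ 2 + x * y + y ^ 2) * (z + p)) +
        7 / 9 * (y * (x ^ 2 + x * z + z ^ 2) * (y + p))) ≤
      13 / 30 * ((y ^ 2 + y * z + z ^ 2) * (x ^ 2 + x * z + z ^ 2) * (x ^ 2 + x * y + y ^ 2) *
      (y + p) * (z + p)) := by
  rcases le_total (7 * z) (2 * y) with h | h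
  · have hs : (1 - 2 * y - z) + (2 * y - 7 * z) + 8 * z = 1 := by ring
    have := interior_poly_wedge₁ (A := 1 - 2 * y - z) (B := 2 * y - 7 * z) (C := 8 * z)
      (y := y) (z := z) (x := x) (p := p) (by linarith) (by linarith) (by linarith) (by ring)
      (by ring) (by linarith) hp
    simp only [hs, mul_one, one_pow] at this
    linarith
  · have hs : (1 - 8 * z) + 16 * (y - z) / 5 + (56 * z - 16 * y) / 5 = 1 := by ring
    have := interior_poly_wedge₂ (A := 1 - 8 * z) (B := 16 * (y - z) / 5)
      (C := (56 * z - 16 * y) / 5)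
      (y := y) (z := z) (x := x) (p := p) (by linarith) (by linarith) (by linarith) (by ring)
      (by ring) (by linarith) hp
    simp only [hs, mul_one, one_pow] at this
    linarith

/-- With `x, y, z` the barycentric coordinates, `1 - y - p` is the squared distance to the vertex of
`y`, and `z + p` is one minus the squared distance to the vertex of `z`. -/
theorem order_poly {x y z p : ℝ} (hx : x = 1 - y - z) (hp : p = x * y + x * z + y * z)
    (hx0 : 0 < x) (hxy : x ≤ y) (hz : 1 / 8 ≤ z) : (1 - y - p) * (z + p) < z := by
  have e : z - (1 - y - p) * (z + p) = y * z - (y * z + (x - x ^ 2)) * (x ^ 2 - y * z) := by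
    rw [hp, show z = 1 - y - x by linarith]; ring
  obtain ⟨q, hq⟩ : ∃ q, q = y * z := ⟨_, rfl⟩
  rw [← hq] at e
  have hqx : x / 8 ≤ q := by
    rw [hq]; nlinarith
  have hx' : x ≤ 7 / 16 := by linarith
  have h1 : (q + (x - x ^ 2)) * (x ^ 2 - q) ≤ (x / 8 + (x - x ^ 2)) * (x ^ 2 - x / 8) := by
    have : 0 ≤ x + q + x / 8 - 2 * x ^ 2 := by nlinarith
    linarith [mul_nonneg (sub_nonneg.2 hqx) this]
  have h2 : (x / 8 + (x - x ^ 2)) * (x ^ 2 - x / 8) < x / 8 := by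
    have : (9 / 8 - x) * (x - 1 / 8) ≤ 1 / 4 := by nlinarith [sq_nonneg (x - 5 / 8)]
    nlinarith [mul_le_mul_of_nonneg_left this (sq_nonneg x)]
  linarith

namespace DegenerateConfig

variable {X Y b T r : Fin 3 → ℝ} {e₁ e₂ : ℝ}

/-- The smallest barycentric coordinate `b k` exceeds `1 / 8`: otherwise the test orthogonal to the
nearest vertex `i` fails, since the weights of the other two are too small. -/
theorem one_eighth_lt_of_le_of_le (h : DegenerateConfig X Y b T r e₁ e₂) {i j k : Fin 3}
    (hij : i ≠ j) (hik : i ≠ k) (hjk : j ≠ k) (h1 : b k ≤ b j) (h2 : b j ≤ b i) :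
    1 / 8 < b k := by
  by_contra! hk8
  have ht := h.radial_test hij hik hjk
  have hs := h.sum_three hij hik hjk
  have hRi := h.r_sq_eq hij hik hjk
  have hRj := h.r_sq_eq hij.symm hjk hik
  have hRk := h.r_sq_eq hik.symm hjk.symm hij
  have hk0 := h.b_nonneg k
  have hTj := h.T_mul j
  have hTk := h.T_mul k
  have hTj0 := h.T_nonneg j
  have hTk0 := h.T_nonneg k
  have hri := pow_pos (h.r_pos i) 2
  have hrj := pow_pos (h.r_pos j) 2
  have hrk := pow_pos (h.r_pos k) 2
  have hcj := half_one_sub_sq_mul_le (r j)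
  have hck := half_one_sub_sq_mul_le (r k)
  generalize hx : b i = x at *
  generalize hy : b j = y at *
  generalize hz : b k = z at *
  obtain ⟨p, hp⟩ : ∃ p, p = x * y + x * z + y * z := ⟨_, rfl⟩
  have hx1 : x = 1 - y - z := by linarith
  have hy0 : 0 < y := by
    rcases (hk0.trans h1).eq_or_lt with h0 | h0
    · have : z = 0 := by linarith
      rw [hRi, ← h0, this] at hri; norm_num at hri
    · exact h0
  have hp0 : 0 < p := by
    have : 0 < x := by linarith
    rw [hp]
    positivity
  have hRj1 : 1 - r j ^ 2 = y + p := by rw [hRj, hp, hx1]; ring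
  have hRk1 : 1 - r k ^ 2 = z + p := by rw [hRk, hp, hx1]; ring
  have hRj4 : 1 / 4 ≤ r j ^ 2 := by
    rw [hRj]; linarith [sq_nonneg (2 * x - 1 + z), sq_nonneg z]
  have hRk4 : 4 / 7 ≤ r k ^ 2 := by
    have e : x ^ 2 + x * y + y ^ 2 = 3 / 4 * (1 - z) ^ 2 + 1 / 4 * (x - y) ^ 2 := by rw [hx1]; ring
    rw [hRk, e]
    linarith [sq_nonneg (x - y),
      mul_nonneg (by linarith : 0 ≤ 1 / 8 - z) (by linarith : 0 ≤ 15 / 8 - z)]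
  -- `1 - r ^ 3 ≥ (1 - r ^ 2) * (2 + r ^ 2) / 2` with `r j ^ 2 ≥ 1 / 4` and `r k ^ 2 ≥ 4 / 7`.
  have bj : T j * (y + p) ≤ 8 / 9 * y := by
    rw [hRj1] at hcj
    have : 9 / 8 * (y + p) ≤ 1 - r j ^ 3 := by
      linarith [mul_le_mul_of_nonneg_left hRj4 (by linarith : 0 ≤ y + p)]
    linarith [mul_le_mul_of_nonneg_left this hTj0]
  have bk : T k * (z + p) ≤ 7 / 9 * z := by
    rw [hRk1] at hck
    have : 9 / 7 * (z + p) ≤ 1 - r k ^ 3 := by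
      linarith [mul_le_mul_of_nonneg_left hRk4 (by linarith : 0 ≤ z + p)]
    linarith [mul_le_mul_of_nonneg_left this hTk0]
  have hP := interior_poly_le hx1 hp hk0 h1 h2 hk8
  rw [← hRi, show x ^ 2 + x * z + z ^ 2 = r j ^ 2 from hRj.symm,
    show x ^ 2 + x * y + y ^ 2 = r k ^ 2 from hRk.symm] at hP
  have hyp : 0 < y + p := by linarith
  have hzp : 0 < z + p := by linarith
  have c1 : T j ≤ 8 / 9 * y / (y + p) := (le_div_iff₀ hyp).2 bj
  have c2 : T k ≤ 7 / 9 * z / (z + p) := (le_div_iff₀ hzp).2 bk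
  have hle : T j / r j ^ 2 * z ^ 2 + T k / r k ^ 2 * y ^ 2 ≤
      8 / 9 * y / (y + p) / r j ^ 2 * z ^ 2 + 7 / 9 * z / (z + p) / r k ^ 2 * y ^ 2 := by gcongr
  have heq : 8 / 9 * y / (y + p) / r j ^ 2 * z ^ 2 + 7 / 9 * z / (z + p) / r k ^ 2 * y ^ 2 =
      y * z * (8 / 9 * (z * r k ^ 2 * (z + p)) + 7 / 9 * (y * r j ^ 2 * (y + p))) /
        (r j ^ 2 * r k ^ 2 * (y + p) * (z + p)) := by
    have := (h.r_pos j).ne'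
    have := (h.r_pos k).ne'
    field_simp
  have hfin : y * z * (8 / 9 * (z * r k ^ 2 * (z + p)) + 7 / 9 * (y * r j ^ 2 * (y + p))) /
        (r j ^ 2 * r k ^ 2 * (y + p) * (z + p)) ≤ 13 / 30 * r i ^ 2 := by
    rw [div_le_iff₀ (by positivity)]
    linarith
  linarith

theorem one_eighth_lt (h : DegenerateConfig X Y b T r e₁ e₂) (i : Fin 3) : 1 / 8 < b i := by
  obtain ⟨j, k, hij, hik, hjk⟩ : ∃ j k : Fin 3, i ≠ j ∧ i ≠ k ∧ j ≠ k := by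
    revert i; decide
  rcases le_total (b i) (b j) with h1 | h1 <;> rcases le_total (b j) (b k) with h2 | h2 <;>
    rcases le_total (b i) (b k) with h3 | h3
  · exact h.one_eighth_lt_of_le_of_le hjk.symm hik.symm hij.symm h1 h2
  · exact h.one_eighth_lt_of_le_of_le hjk.symm hik.symm hij.symm h1 h2
  · exact h.one_eighth_lt_of_le_of_le hjk hij.symm hik.symm h3 h2
  · exact (h.one_eighth_lt_of_le_of_le hij.symm hjk hik h3 h1).trans_le h3
  · exact (h.one_eighth_lt_of_le_of_le hik.symm hjk.symm hij h1 h3).trans_le h1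
  · exact (h.one_eighth_lt_of_le_of_le hik hij hjk.symm h2 h3).trans_le h1
  · exact (h.one_eighth_lt_of_le_of_le hij hik hjk h2 h1).trans_le (h2.trans h1)
  · exact (h.one_eighth_lt_of_le_of_le hij hik hjk h2 h1).trans_le h3

/-- The sum of the `T i` is `s / (s - 1)`, so this says `s > 2`. -/
theorem sum_T_lt_two (h : DegenerateConfig X Y b T r e₁ e₂) : ∑ i, T i < 2 := by
  -- The bounds `(1 + b i) / 2` add up to `2`.
  have key : ∀ i, T i < (1 + b i) / 2 := by
    intro i
    obtain ⟨j, k, hij, hik, hjk⟩ : ∃ j k : Fin 3, i ≠ j ∧ i ≠ k ∧ j ≠ k := by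
      revert i; decide
    have hs := h.sum_three hij hik hjk
    have hR := h.r_sq_eq hij hik hjk
    have hi := h.one_eighth_lt i
    have hj := h.one_eighth_lt j
    have hk := h.one_eighth_lt k
    have hr := h.r_lt_one (by linarith : 0 < b i)
    have hT := h.T_mul i
    have hT0 := h.T_nonneg i
    have h3 : r i ^ 3 ≤ r i ^ 2 := pow_le_pow_of_le_one (h.r_pos i).le hr.le (by norm_num)
    have h1 : b i * (2 - b i) ≤ 1 - r i ^ 3 := by
      have e : 1 - r i ^ 2 = b i * (2 - b i) + b j * b k := by
        rw [hR, show b i = 1 - b j - b k by linarith]; ring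
      have : 0 < b j * b k := mul_pos (by linarith) (by linarith)
      linarith
    have h2 : T i * (2 - b i) ≤ 1 := by
      refine le_of_mul_le_mul_left ?_ (by linarith : 0 < b i)
      linarith [mul_le_mul_of_nonneg_left h1 hT0]
    refine lt_of_mul_lt_mul_right ?_ (by linarith : 0 ≤ 2 - b i)
    linarith [mul_pos (by linarith : 0 < b i) (by linarith : 0 < 1 - b i)]
  have hs := h.sum_b
  simp only [Fin.sum_univ_three] at hs ⊢
  linarith [key 0, key 1, key 2]

/-- The masses are `T i * r i ^ 3`, up to a common factor. Of two vertices the lighter one has the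
larger barycentric coordinate, if the third coordinate is at most that of the heavier one. -/
theorem b_le_of_mass_le (h : DegenerateConfig X Y b T r e₁ e₂) {i j k : Fin 3} (hij : i ≠ j)
    (hik : i ≠ k) (hjk : j ≠ k) (hm : T k * r k ^ 3 ≤ T j * r j ^ 3) (hb : b i ≤ b j) :
    b j ≤ b k := by
  by_contra! hlt
  have hs := h.sum_three hij hik hjk
  have hRj := h.r_sq_eq hij.symm hjk hik
  have hRk := h.r_sq_eq hik.symm hjk.symm hij
  have hi8 := h.one_eighth_lt i
  have hk8 := h.one_eighth_lt k
  have hrj := h.r_lt_one (by linarith : 0 < b j)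
  have hrk := h.r_lt_one (by linarith : 0 < b k)
  have hrj0 := h.r_pos j
  have hrk0 := h.r_pos k
  have hTj := h.T_mul j
  have hTk := h.T_mul k
  generalize hx : b i = x at *
  generalize hy : b j = y at *
  generalize hz : b k = z at *
  obtain ⟨p, hp⟩ : ∃ p, p = x * y + x * z + y * z := ⟨_, rfl⟩
  have hx1 : x = 1 - y - z := by linarith
  have hRj1 : r j ^ 2 = 1 - y - p := by rw [hRj, hp, hx1]; ring
  have hRk1 : r k ^ 2 = 1 - z - p := by rw [hRk, hp, hx1]; ring
  obtain ⟨u, hu⟩ : ∃ u, r j = u := ⟨_, rfl⟩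
  obtain ⟨v, hv⟩ : ∃ v, r k = v := ⟨_, rfl⟩
  rw [hu] at hRj1 hrj hrj0 hTj hm
  rw [hv] at hRk1 hrk hrk0 hTk hm
  -- Since `y - z = v ^ 2 - u ^ 2`, the factor `v - u` cancels from the comparison of masses.
  have huv : u < v := by
    apply lt_of_pow_lt_pow_left₀ 2 hrk0.le; linarith
  have hu3 : 0 < 1 - u ^ 3 := sub_pos.2 (pow_lt_one₀ hrj0.le hrj (by norm_num))
  have hv3 : 0 < 1 - v ^ 3 := sub_pos.2 (pow_lt_one₀ hrk0.le hrk (by norm_num))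
  have h1 : z * v ^ 3 * (1 - u ^ 3) ≤ y * u ^ 3 * (1 - v ^ 3) := by
    rw [← hTj, ← hTk]
    linarith [mul_le_mul_of_nonneg_right hm (mul_pos hu3 hv3).le]
  have h2 : z * (v ^ 2 + v * u + u ^ 2) ≤ (v + u) * u ^ 3 * (1 - v ^ 3) := by
    have e : y = z + (v ^ 2 - u ^ 2) := by linarith
    rw [e] at h1
    refine le_of_mul_le_mul_left ?_ (sub_pos.2 huv)
    linarith
  have h3 : 3 * (u * (v + u)) ≤ 2 * (v ^ 2 + v * u + u ^ 2) := by
    nlinarith [mul_pos (sub_pos.2 huv) (by linarith : 0 < 2 * v + u)]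
  have h4 : 3 * z ≤ 2 * (u ^ 2 * (1 - v ^ 3)) := by
    have hc : 0 < v ^ 2 + v * u + u ^ 2 := by positivity
    refine le_of_mul_le_mul_left ?_ hc
    have := mul_le_mul_of_nonneg_right h3 (by positivity : 0 ≤ u ^ 2 * (1 - v ^ 3))
    linarith
  have h5 := mul_le_mul_of_nonneg_left (one_sub_cube_le hrk0.le) (sq_nonneg u)
  have h6 := order_poly hx1 hp (by linarith) hb hk8.le
  rw [hRk1, hRj1] at h5
  rw [hRj1] at h4
  linarith

/-- The lightest primary has the largest barycentric coordinate. -/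
theorem max_of_mass_le (h : DegenerateConfig X Y b T r e₁ e₂) {i j k : Fin 3} (hij : i ≠ j)
    (hik : i ≠ k) (hjk : j ≠ k) (hi : T k * r k ^ 3 ≤ T i * r i ^ 3)
    (hj : T k * r k ^ 3 ≤ T j * r j ^ 3) : b i ≤ b k ∧ b j ≤ b k := by
  rcases le_total (b i) (b j) with hb | hb
  · have := h.b_le_of_mass_le hij hik hjk hj hb
    exact ⟨hb.trans this, this⟩
  · have := h.b_le_of_mass_le hij.symm hjk hik hi hb
    exact ⟨this, hb.trans this⟩

/-- The variance of the vertices in the null direction, for the probability weights `b i`, is at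
most `1 / 9`: since `r ^ 2 * (1 - r ^ 3) ≤ 1 / 3`, the matrix with eigenvalue `1 / 3` dominates
three times the covariance matrix. -/
theorem variance_le (h : DegenerateConfig X Y b T r e₁ e₂) :
    b 0 * b 1 * ((X 0 - X 1) * e₁ + (Y 0 - Y 1) * e₂) ^ 2 +
      b 0 * b 2 * ((X 0 - X 2) * e₁ + (Y 0 - Y 2) * e₂) ^ 2 +
      b 1 * b 2 * ((X 1 - X 2) * e₁ + (Y 1 - Y 2) * e₂) ^ 2 ≤ (e₁ ^ 2 + e₂ ^ 2) / 9 := by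
  have hq := h.null_quad (i := 0) (j := 1) (k := 2) (by decide) (by decide) (by decide)
  have key : ∀ i, 3 * b i ≤ T i / r i ^ 2 := fun i => by
    rw [le_div_iff₀ (pow_pos (h.r_pos i) 2), ← h.T_mul i]
    linarith [mul_le_mul_of_nonneg_left (sq_mul_one_sub_cube_le (h.r_pos i).le) (h.T_nonneg i)]
  have key' : ∀ i, 3 * b i * (X i * e₁ + Y i * e₂) ^ 2 ≤
      T i / r i ^ 2 * (X i * e₁ + Y i * e₂) ^ 2 := fun i =>
    mul_le_mul_of_nonneg_right (key i) (sq_nonneg _)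
  have hs := h.sum_b
  have hx := h.sum_bX
  have hy := h.sum_bY
  simp only [Fin.sum_univ_three] at hs hx hy
  have hvar : b 0 * b 1 * ((X 0 - X 1) * e₁ + (Y 0 - Y 1) * e₂) ^ 2 +
      b 0 * b 2 * ((X 0 - X 2) * e₁ + (Y 0 - Y 2) * e₂) ^ 2 +
      b 1 * b 2 * ((X 1 - X 2) * e₁ + (Y 1 - Y 2) * e₂) ^ 2 =
      (b 0 * (X 0 * e₁ + Y 0 * e₂) ^ 2 + b 1 * (X 1 * e₁ + Y 1 * e₂) ^ 2 +
        b 2 * (X 2 * e₁ + Y 2 * e₂) ^ 2) := by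
    have hl : b 0 * (X 0 * e₁ + Y 0 * e₂) + b 1 * (X 1 * e₁ + Y 1 * e₂) +
        b 2 * (X 2 * e₁ + Y 2 * e₂) = 0 := by linear_combination e₁ * hx + e₂ * hy
    linear_combination (b 0 * (X 0 * e₁ + Y 0 * e₂) ^ 2 + b 1 * (X 1 * e₁ + Y 1 * e₂) ^ 2 +
        b 2 * (X 2 * e₁ + Y 2 * e₂) ^ 2) * hs -
        (b 0 * (X 0 * e₁ + Y 0 * e₂) + b 1 * (X 1 * e₁ + Y 1 * e₂) +
        b 2 * (X 2 * e₁ + Y 2 * e₂)) * hl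
  rw [hvar]
  linarith [key' 0, key' 1, key' 2]

/-- The vertical direction is not null. In units of `c`, the heights of the vertices are `0`, `-m₃`
and `m₂`, the last being the height of the lightest one. As that vertex carries the largest
weight `b`, the variance of the heights is greater than `1 / 9`. -/
theorem not_null_vertical (h : DegenerateConfig X Y b T r 0 1) {m₂ m₃ c : ℝ} (hm₃ : 0 ≤ m₃)
    (hm : m₃ ≤ m₂) (hc : c ^ 2 * (m₂ ^ 2 + m₂ * m₃ + m₃ ^ 2) = 3 / 4)
    (hY₁ : Y 1 = Y 0 + c * m₃) (hY₂ : Y 2 = Y 0 - c * m₂)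
    (h₀ : T 2 * r 2 ^ 3 ≤ T 0 * r 0 ^ 3) (h₁ : T 2 * r 2 ^ 3 ≤ T 1 * r 1 ^ 3) : False := by
  obtain ⟨hb0, hb1⟩ := h.max_of_mass_le (i := 0) (j := 1) (k := 2) (by decide) (by decide)
    (by decide) h₀ h₁
  have hs := h.sum_b
  simp only [Fin.sum_univ_three] at hs
  have h0 := h.one_eighth_lt 0
  have h1 := h.one_eighth_lt 1
  have hv := h.variance_le
  rw [hY₁, hY₂] at hv
  generalize hx : b 0 = x at *
  generalize hy : b 1 = y at *
  generalize hz : b 2 = z at *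
  have hx1 : x = 1 - y - z := by linarith
  have hv' : 27 * c ^ 2 * (x * y * m₃ ^ 2 + x * z * m₂ ^ 2 + y * z * (m₂ + m₃) ^ 2) ≤
      4 * (c ^ 2 * (m₂ ^ 2 + m₂ * m₃ + m₃ ^ 2)) := by
    rw [hc]; linarith
  have hc0 : 0 < c ^ 2 := by
    have : c ≠ 0 := by rintro rfl; norm_num at hc
    positivity
  have hM : 0 < m₂ ^ 2 + m₂ * m₃ + m₃ ^ 2 := by
    by_contra! hM
    have := mul_nonpos_of_nonneg_of_nonpos hc0.le hM
    linarith
  have hv2 : 27 * (x * y * m₃ ^ 2 + x * z * m₂ ^ 2 + y * z * (m₂ + m₃) ^ 2) ≤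
      4 * (m₂ ^ 2 + m₂ * m₃ + m₃ ^ 2) := le_of_mul_le_mul_left (by linarith) hc0
  -- In `m₃` and `t = m₂ - m₃`, both nonnegative, the reverse of `hv2` has positive coefficients.
  obtain ⟨t, rfl⟩ : ∃ t, m₂ = m₃ + t := ⟨m₂ - m₃, by ring⟩
  have ht : 0 ≤ t := by linarith
  have hxz : 1 / 4 - z / 12 ≤ x * z + y * z := by
    rw [hx1]
    linarith [mul_nonneg (by linarith : 0 ≤ z - 1 / 3) (by linarith : 0 ≤ 3 / 4 - z)]
  have hA : 0 < 27 * (x * z + y * z) - 4 := by linarith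
  have hB : 0 < 27 * (2 * (x * z + y * z) + 2 * (y * z)) - 12 := by
    linarith [mul_le_mul_of_nonneg_right h1.le (by linarith : 0 ≤ z)]
  have hC : 0 < 27 * (x * y + x * z + 4 * (y * z)) - 12 := by
    clear hv hv' hv2 hM hc hY₂
    have p1 := mul_nonneg (by linarith : 0 ≤ y - 1 / 8) (by linarith : 0 ≤ z - x)
    have p2 := mul_nonneg (by linarith : 0 ≤ x - 1 / 8) (by linarith : 0 ≤ z - y)
    have p3 := mul_nonneg (by linarith : 0 ≤ y - 1 / 8) (by linarith : 0 ≤ z - y)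
    have p4 := mul_nonneg (by linarith : 0 ≤ x - 1 / 8) (by linarith : 0 ≤ z - x)
    have p5 := mul_nonneg (by linarith : 0 ≤ x - 1 / 8) (by linarith : 0 ≤ y - 1 / 8)
    subst hx1
    nlinarith
  have hpos : 0 < m₃ ∨ 0 < t := by
    by_contra! hn
    have e1 : m₃ = 0 := le_antisymm hn.1 hm₃
    have e2 : t = 0 := le_antisymm hn.2 ht
    rw [e1, e2] at hM; norm_num at hM
  rcases hpos with hp | hp
  · linarith [mul_nonneg hA.le (sq_nonneg t), mul_nonneg hB.le (mul_nonneg ht hm₃),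
      mul_pos hC (pow_pos hp 2)]
  · linarith [mul_pos hA (pow_pos hp 2), mul_nonneg hB.le (mul_nonneg ht hm₃),
      mul_nonneg hC.le (sq_nonneg m₃)]

end DegenerateConfig

/-! ### Degenerate configurations from critical equilibria -/

/-- The squared area of an equilateral triangle of side one, up to the factor `4`. -/
theorem cross_sq_of_sides {X Y : Fin 3 → ℝ}
    (side : ∀ i j, i ≠ j → (X i - X j) ^ 2 + (Y i - Y j) ^ 2 = 1) :
    ((X 1 - X 0) * (Y 2 - Y 0) - (X 2 - X 0) * (Y 1 - Y 0)) ^ 2 = 3 / 4 := by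
  have s01 := side 0 1 (by decide)
  have s02 := side 0 2 (by decide)
  have s12 := side 1 2 (by decide)
  have hdot : (X 1 - X 0) * (X 2 - X 0) + (Y 1 - Y 0) * (Y 2 - Y 0) = 1 / 2 := by
    linear_combination (s01 + s02 - s12) / 2
  have : ((X 1 - X 0) * (Y 2 - Y 0) - (X 2 - X 0) * (Y 1 - Y 0)) ^ 2 =
      ((X 0 - X 1) ^ 2 + (Y 0 - Y 1) ^ 2) * ((X 0 - X 2) ^ 2 + (Y 0 - Y 2) ^ 2) -
      ((X 1 - X 0) * (X 2 - X 0) + (Y 1 - Y 0) * (Y 2 - Y 0)) ^ 2 := by ring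
  rw [this, hdot, s01, s02]; norm_num

/-- An equilibrium with a null vector of the Hessian is a degenerate configuration. The hypotheses
`hX`, `hY` are the equilibrium equations, `hn₁`, `hn₂` say that `(e₁, e₂)` is a null vector of
`(1 - s) + 3 ∑ i, m i / r i ^ 5 * (X i, Y i) ⊗ (X i, Y i)`. -/
theorem degenerateConfig_of_null {m X Y r : Fin 3 → ℝ} {e₁ e₂ s : ℝ} (hm : ∀ i, 0 ≤ m i)
    (hsum : ∑ i, m i = 1) (h0 : 0 < m 0) (h1 : 0 < m 1)
    (side : ∀ i j, i ≠ j → (X i - X j) ^ 2 + (Y i - Y j) ^ 2 = 1)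
    (hr0 : ∀ i, 0 ≤ r i) (hr : ∀ i, r i ^ 2 = X i ^ 2 + Y i ^ 2) (hreg : ∀ i, m i ≠ 0 → r i ≠ 0)
    (hs : s = ∑ i, m i / r i ^ 3)
    (hX : ∑ i, m i / r i ^ 3 * X i = ∑ i, m i * X i)
    (hY : ∑ i, m i / r i ^ 3 * Y i = ∑ i, m i * Y i) (he : e₁ ≠ 0 ∨ e₂ ≠ 0)
    (hn₁ : (1 - s) * e₁ + 3 * ∑ i, m i / r i ^ 5 * (X i * e₁ + Y i * e₂) * X i = 0)
    (hn₂ : (1 - s) * e₂ + 3 * ∑ i, m i / r i ^ 5 * (X i * e₁ + Y i * e₂) * Y i = 0) :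
    1 < s ∧ DegenerateConfig X Y (fun i => m i / r i ^ 3 / (s - 1) * (1 - r i ^ 3))
      (fun i => m i / r i ^ 3 / (s - 1)) r e₁ e₂ := by
  have hr0' : 0 < r 0 := (hr0 0).lt_of_ne' (hreg 0 h0.ne')
  have hr1' : 0 < r 1 := (hr0 1).lt_of_ne' (hreg 1 h1.ne')
  have hcross := cross_sq_of_sides side
  have hw : ∀ i, m i / r i ^ 3 * r i ^ 3 = m i := fun i => by
    by_cases h : m i = 0
    · simp [h]
    · have := hreg i h
      field_simp
  have hquad : ∑ i, m i / r i ^ 5 * (X i * e₁ + Y i * e₂) ^ 2 =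
      (s - 1) / 3 * (e₁ ^ 2 + e₂ ^ 2) := by
    simp only [Fin.sum_univ_three] at hn₁ hn₂ ⊢
    linear_combination (e₁ * hn₁ + e₂ * hn₂) / 3
  have hterm : ∀ i, 0 ≤ m i / r i ^ 5 * (X i * e₁ + Y i * e₂) ^ 2 := fun i => by
    have := hm i; have := hr0 i; positivity
  have hee : 0 < e₁ ^ 2 + e₂ ^ 2 := by rcases he with h | h <;> positivity
  -- If `s ≤ 1`, the Hessian is positive semidefinite, so `s = 1` and `e` is orthogonal to the
  -- directions of the two massive vertices, while equilibrium puts the point at distance one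
  -- from both: these directions are linearly independent.
  have hs1 : 1 < s := by
    by_contra! hle
    have hz : ∑ i, m i / r i ^ 5 * (X i * e₁ + Y i * e₂) ^ 2 = 0 := by
      refine le_antisymm ?_ (Finset.sum_nonneg fun i _ => hterm i)
      rw [hquad]
      exact mul_nonpos_of_nonpos_of_nonneg (by linarith) hee.le
    have hseq : s = 1 := by
      rw [hz] at hquad
      rcases mul_eq_zero.1 hquad.symm with h | h
      · linarith
      · exact absurd h hee.ne'
    have hzero := (Finset.sum_eq_zero_iff_of_nonneg fun i _ => hterm i).1 hz
    have hperp : ∀ i, 0 < m i → 0 < r i → X i * e₁ + Y i * e₂ = 0 := fun i hmi hri => by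
      rcases mul_eq_zero.1 (hzero i (Finset.mem_univ i)) with h | h
      · exact absurd h (by positivity)
      · exact pow_eq_zero_iff two_ne_zero |>.1 h
    have hp0 := hperp 0 h0 hr0'
    have hp1 := hperp 1 h1 hr1'
    have hpar : X 0 * Y 1 - X 1 * Y 0 = 0 := by
      rcases he with h | h
      · refine (mul_eq_zero.1 (?_ : (X 0 * Y 1 - X 1 * Y 0) * e₁ = 0)).resolve_right h
        linear_combination Y 1 * hp0 - Y 0 * hp1
      · refine (mul_eq_zero.1 (?_ : (X 0 * Y 1 - X 1 * Y 0) * e₂ = 0)).resolve_right h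
        linear_combination X 0 * hp1 - X 1 * hp0
    rw [hseq] at hs
    simp only [Fin.sum_univ_three] at hs hsum hX hY
    have hcne : (X 1 - X 0) * (Y 2 - Y 0) - (X 2 - X 0) * (Y 1 - Y 0) ≠ 0 := by
      intro h; rw [h] at hcross; norm_num at hcross
    have hq1 : m 1 / r 1 ^ 3 - m 1 = 0 := by
      refine (mul_eq_zero.1 (?_ : _ * ((X 1 - X 0) * (Y 2 - Y 0) -
        (X 2 - X 0) * (Y 1 - Y 0)) = 0)).resolve_right hcne
      linear_combination (Y 2 - Y 0) * hX - (X 2 - X 0) * hY +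
        (X 0 * (Y 2 - Y 0) - Y 0 * (X 2 - X 0)) * (hs + hsum)
    have hq2 : m 2 / r 2 ^ 3 - m 2 = 0 := by
      refine (mul_eq_zero.1 (?_ : _ * ((X 1 - X 0) * (Y 2 - Y 0) -
        (X 2 - X 0) * (Y 1 - Y 0)) = 0)).resolve_right hcne
      linear_combination (X 1 - X 0) * hY - (Y 1 - Y 0) * hX +
        (Y 0 * (X 1 - X 0) - X 0 * (Y 1 - Y 0)) * (hs + hsum)
    have hq0 : m 0 / r 0 ^ 3 - m 0 = 0 := by linarith
    have hone : ∀ i, 0 < m i → m i / r i ^ 3 - m i = 0 → r i ^ 2 = 1 := fun i hmi hi => by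
      have h3 : m i * (r i ^ 3 - 1) = 0 := by linear_combination hw i - r i ^ 3 * hi
      have h3' : r i ^ 3 = 1 := by
        rcases mul_eq_zero.1 h3 with h | h <;> linarith
      rw [(pow_eq_one_iff_of_nonneg (hr0 i) (by norm_num)).1 h3', one_pow]
    have hu0 := hone 0 h0 hq0
    have hu1 := hone 1 h1 hq1
    rw [hr] at hu0 hu1
    have s01 := side 0 1 (by decide)
    have hdot : X 0 * X 1 + Y 0 * Y 1 = 1 / 2 := by linear_combination (hu0 + hu1 - s01) / 2
    have : (X 0 * X 1 + Y 0 * Y 1) ^ 2 + (X 0 * Y 1 - X 1 * Y 0) ^ 2 =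
      (X 0 ^ 2 + Y 0 ^ 2) * (X 1 ^ 2 + Y 1 ^ 2) := by ring
    rw [hdot, hpar, hu0, hu1] at this
    norm_num at this
  have hμ : 0 < s - 1 := by linarith
  have hb : ∀ i, m i / r i ^ 3 / (s - 1) * (1 - r i ^ 3) = (m i / r i ^ 3 - m i) / (s - 1) :=
    fun i => by rw [div_mul_eq_mul_div, mul_sub, hw, mul_one]
  have sum_b : ∑ i, m i / r i ^ 3 / (s - 1) * (1 - r i ^ 3) = 1 := by
    simp only [hb, ← Finset.sum_div, Finset.sum_sub_distrib, ← hs, hsum]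
    exact div_self hμ.ne'
  have sum_bX : ∑ i, m i / r i ^ 3 / (s - 1) * (1 - r i ^ 3) * X i = 0 := by
    simp only [hb, div_mul_eq_mul_div, ← Finset.sum_div, sub_mul, Finset.sum_sub_distrib]
    simp [← hX, div_mul_eq_mul_div]
  have sum_bY : ∑ i, m i / r i ^ 3 / (s - 1) * (1 - r i ^ 3) * Y i = 0 := by
    simp only [hb, div_mul_eq_mul_div, ← Finset.sum_div, sub_mul, Finset.sum_sub_distrib]
    simp [← hY, div_mul_eq_mul_div]
  -- The point may coincide with the third vertex only if that vertex is massless; but then its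
  -- barycentric coordinate there would vanish, instead of being one.
  have hr2' : 0 < r 2 := by
    refine (hr0 2).lt_of_ne' fun hr2 => ?_
    have hd : X 2 ^ 2 + Y 2 ^ 2 = 0 := by rw [← hr, hr2]; norm_num
    have hx2 : X 2 = 0 := pow_eq_zero_iff two_ne_zero |>.1
      (le_antisymm (by linarith [sq_nonneg (Y 2)]) (sq_nonneg (X 2)))
    have hy2 : Y 2 = 0 := pow_eq_zero_iff two_ne_zero |>.1
      (le_antisymm (by linarith [sq_nonneg (X 2)]) (sq_nonneg (Y 2)))
    have hm2 : m 2 = 0 := by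
      by_contra hne
      exact hreg 2 hne hr2
    simp only [Fin.sum_univ_three, hm2, hx2, hy2, zero_div, zero_mul, add_zero, zero_sub]
      at sum_b sum_bX sum_bY hcross
    set b₀ := m 0 / r 0 ^ 3 / (s - 1) * (1 - r 0 ^ 3)
    set b₁ := m 1 / r 1 ^ 3 / (s - 1) * (1 - r 1 ^ 3)
    have hc : X 0 * Y 1 - X 1 * Y 0 ≠ 0 := by
      intro h
      rw [show (X 1 - X 0) * -Y 0 - -X 0 * (Y 1 - Y 0) = X 0 * Y 1 - X 1 * Y 0 by ring,
        h] at hcross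
      norm_num at hcross
    have hb0 : b₀ * (X 0 * Y 1 - X 1 * Y 0) = 0 := by
      linear_combination Y 1 * sum_bX - X 1 * sum_bY
    have hb1 : b₁ * (X 0 * Y 1 - X 1 * Y 0) = 0 := by
      linear_combination X 0 * sum_bY - Y 0 * sum_bX
    have hb0' := (mul_eq_zero.1 hb0).resolve_right hc
    have hb1' := (mul_eq_zero.1 hb1).resolve_right hc
    linarith
  have hpos : ∀ i, 0 < r i := by
    intro i; fin_cases i <;> assumption
  refine ⟨hs1, ⟨sum_b, sum_bX, sum_bY, side, hpos, hr, fun i => ?_, fun i => rfl, ?_, he, ?_, ?_⟩⟩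
  · have := hm i; have := hr0 i; positivity
  · rw [← Finset.sum_div, ← hs, one_lt_div hμ]; linarith
  · have : ∀ i, m i / r i ^ 3 / (s - 1) / r i ^ 2 = m i / r i ^ 5 / (s - 1) := fun i => by
      rw [div_right_comm, div_div (m i), ← pow_add]
    simp only [this, div_mul_eq_mul_div, ← Finset.sum_div] at hn₁ ⊢
    rw [div_eq_div_iff hμ.ne' (by norm_num)]
    linarith
  · have : ∀ i, m i / r i ^ 3 / (s - 1) / r i ^ 2 = m i / r i ^ 5 / (s - 1) := fun i => by
      rw [div_right_comm, div_div (m i), ← pow_add]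
    simp only [this, div_mul_eq_mul_div, ← Finset.sum_div] at hn₂ ⊢
    rw [div_eq_div_iff hμ.ne' (by norm_num)]
    linarith

/-! ### Derivatives of the effective potential -/

theorem dist2_sq (a b x y : ℝ) : dist2 a b x y ^ 2 = (x - a) ^ 2 + (y - b) ^ 2 :=
  Real.sq_sqrt (by positivity)

theorem dist2_nonneg (a b x y : ℝ) : 0 ≤ dist2 a b x y := Real.sqrt_nonneg _

theorem sq_dist_pos {a b x y : ℝ} (h : (x, y) ≠ (a, b)) : 0 < (x - a) ^ 2 + (y - b) ^ 2 := by
  rcases not_and_or.1 (mt Prod.mk_inj.2 h) with h | h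
  · have := sub_ne_zero.2 h; positivity
  · have := sub_ne_zero.2 h; positivity

theorem dist2_pos {a b x y : ℝ} (h : (x, y) ≠ (a, b)) : 0 < dist2 a b x y :=
  Real.sqrt_pos.2 (sq_dist_pos h)

theorem hasDerivAt_dist2_fst {a b x y : ℝ} (h : (x, y) ≠ (a, b)) :
    HasDerivAt (fun s => dist2 a b s y) ((x - a) / dist2 a b x y) x := by
  have h1 : HasDerivAt (fun s => (s - a) ^ 2 + (y - b) ^ 2) (2 * (x - a)) x := by
    simpa using (((hasDerivAt_id x).sub_const a).pow 2).add_const ((y - b) ^ 2)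
  refine (h1.sqrt (sq_dist_pos h).ne').congr_deriv ?_
  unfold dist2
  rw [mul_div_mul_left _ _ two_ne_zero]

theorem hasDerivAt_dist2_snd {a b x y : ℝ} (h : (x, y) ≠ (a, b)) :
    HasDerivAt (fun s => dist2 a b x s) ((y - b) / dist2 a b x y) y := by
  have h1 : HasDerivAt (fun s => (x - a) ^ 2 + (s - b) ^ 2) (2 * (y - b)) y := by
    simpa using (((hasDerivAt_id y).sub_const b).pow 2).const_add ((x - a) ^ 2)
  refine (h1.sqrt (sq_dist_pos h).ne').congr_deriv ?_
  unfold dist2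
  rw [mul_div_mul_left _ _ two_ne_zero]

/-- The potential `m / dist2 a b` is smooth at `(x, y)`: the point is not a mass at `(a, b)`. A zero
mass imposes nothing, the potential being identically zero. -/
def Regular (m a b x y : ℝ) : Prop := m ≠ 0 → (x, y) ≠ (a, b)

theorem eventually_regular {m a b x y : ℝ} (h : Regular m a b x y) :
    ∀ᶠ p : ℝ × ℝ in 𝓝 (x, y), Regular m a b p.1 p.2 := by
  by_cases hm : m = 0
  · exact .of_forall fun p hp => absurd hm hp
  · exact (eventually_ne_nhds (h hm)).mono fun p hp _ => hp

namespace Regular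

variable {m a b x y : ℝ}

theorem hasDerivAt_potential_fst (h : Regular m a b x y) :
    HasDerivAt (fun s => m / dist2 a b s y) (-(m / dist2 a b x y ^ 3 * (x - a))) x := by
  by_cases hm : m = 0
  · simpa [hm] using hasDerivAt_const x (0 : ℝ)
  have hd := (dist2_pos (h hm)).ne'
  refine ((hasDerivAt_const x m).div (hasDerivAt_dist2_fst (h hm)) hd).congr_deriv ?_
  field_simp; ring

theorem hasDerivAt_potential_snd (h : Regular m a b x y) :
    HasDerivAt (fun s => m / dist2 a b x s) (-(m / dist2 a b x y ^ 3 * (y - b))) y := by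
  by_cases hm : m = 0
  · simpa [hm] using hasDerivAt_const y (0 : ℝ)
  have hd := (dist2_pos (h hm)).ne'
  refine ((hasDerivAt_const y m).div (hasDerivAt_dist2_snd (h hm)) hd).congr_deriv ?_
  field_simp; ring

theorem hasDerivAt_force_fst_fst (h : Regular m a b x y) :
    HasDerivAt (fun s => m / dist2 a b s y ^ 3 * (s - a))
      (m / dist2 a b x y ^ 3 - 3 * (m / dist2 a b x y ^ 5 * (x - a) ^ 2)) x := by
  by_cases hm : m = 0
  · simpa [hm] using hasDerivAt_const x (0 : ℝ)
  have hd := (dist2_pos (h hm)).ne'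
  refine (((hasDerivAt_const x m).div ((hasDerivAt_dist2_fst (h hm)).pow 3) (pow_ne_zero 3 hd)).mul
    ((hasDerivAt_id x).sub_const a)).congr_deriv ?_
  simp only [Pi.pow_apply, Pi.div_apply, id]
  field_simp; ring

theorem hasDerivAt_force_fst_snd (h : Regular m a b x y) :
    HasDerivAt (fun s => m / dist2 a b x s ^ 3 * (x - a))
      (-(3 * (m / dist2 a b x y ^ 5 * (x - a) * (y - b)))) y := by
  by_cases hm : m = 0
  · simpa [hm] using hasDerivAt_const y (0 : ℝ)
  have hd := (dist2_pos (h hm)).ne'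
  refine (((hasDerivAt_const y m).div ((hasDerivAt_dist2_snd (h hm)).pow 3)
    (pow_ne_zero 3 hd)).mul_const (x - a)).congr_deriv ?_
  simp only [Pi.pow_apply]
  field_simp; ring

theorem hasDerivAt_force_snd_fst (h : Regular m a b x y) :
    HasDerivAt (fun s => m / dist2 a b s y ^ 3 * (y - b))
      (-(3 * (m / dist2 a b x y ^ 5 * (x - a) * (y - b)))) x := by
  by_cases hm : m = 0
  · simpa [hm] using hasDerivAt_const x (0 : ℝ)
  have hd := (dist2_pos (h hm)).ne'
  refine (((hasDerivAt_const x m).div ((hasDerivAt_dist2_fst (h hm)).pow 3)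
    (pow_ne_zero 3 hd)).mul_const (y - b)).congr_deriv ?_
  simp only [Pi.pow_apply]
  field_simp; ring

theorem hasDerivAt_force_snd_snd (h : Regular m a b x y) :
    HasDerivAt (fun s => m / dist2 a b x s ^ 3 * (s - b))
      (m / dist2 a b x y ^ 3 - 3 * (m / dist2 a b x y ^ 5 * (y - b) ^ 2)) y := by
  by_cases hm : m = 0
  · simpa [hm] using hasDerivAt_const y (0 : ℝ)
  have hd := (dist2_pos (h hm)).ne'
  refine (((hasDerivAt_const y m).div ((hasDerivAt_dist2_snd (h hm)).pow 3) (pow_ne_zero 3 hd)).mul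
    ((hasDerivAt_id y).sub_const b)).congr_deriv ?_
  simp only [Pi.pow_apply, Pi.div_apply, id]
  field_simp; ring

theorem differentiableAt_inv_cube (h : Regular m a b x y) :
    DifferentiableAt ℝ (fun p : ℝ × ℝ => m / dist2 a b p.1 p.2 ^ 3) (x, y) := by
  by_cases hm : m = 0
  · simp [hm]
  have hd := (dist2_pos (h hm)).ne'
  have h1 : DifferentiableAt ℝ (fun p : ℝ × ℝ => dist2 a b p.1 p.2) (x, y) :=
    DifferentiableAt.sqrt (by fun_prop) (sq_dist_pos (h hm)).ne'
  simpa only [div_eq_mul_inv] using ((h1.fun_pow 3).fun_inv (pow_ne_zero 3 hd)).const_mul m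

end Regular

/-- The point `(x, y)` is not the position of a primary of positive mass. -/
def NoCollision (m₁ m₂ m₃ x y : ℝ) : Prop :=
  Regular m₁ (x₁ m₁ m₂ m₃) (y₁ m₁ m₂ m₃) x y ∧ Regular m₂ (x₂ m₁ m₂ m₃) (y₂ m₁ m₂ m₃) x y ∧
    Regular m₃ (x₃ m₁ m₂ m₃) (y₃ m₁ m₂ m₃) x y

variable {m₁ m₂ m₃ x y : ℝ}

theorem NoCollision.eventually (h : NoCollision m₁ m₂ m₃ x y) :
    ∀ᶠ p : ℝ × ℝ in 𝓝 (x, y), NoCollision m₁ m₂ m₃ p.1 p.2 :=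
  (eventually_regular h.1).and ((eventually_regular h.2.1).and (eventually_regular h.2.2))

theorem Ωx_eq (h : NoCollision m₁ m₂ m₃ x y) :
    Ωx m₁ m₂ m₃ x y = x - m₁ / r₁ m₁ m₂ m₃ x y ^ 3 * (x - x₁ m₁ m₂ m₃) -
      m₂ / r₂ m₁ m₂ m₃ x y ^ 3 * (x - x₂ m₁ m₂ m₃) -
      m₃ / r₃ m₁ m₂ m₃ x y ^ 3 * (x - x₃ m₁ m₂ m₃) := by
  have h0 : HasDerivAt (fun s : ℝ => 1 / 2 * (s ^ 2 + y ^ 2)) x x := by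
    refine ((((hasDerivAt_id x).pow 2).add_const (y ^ 2)).const_mul (1 / 2 : ℝ)).congr_deriv ?_
    simp
  refine (((h0.add h.1.hasDerivAt_potential_fst).add h.2.1.hasDerivAt_potential_fst).add
    h.2.2.hasDerivAt_potential_fst).deriv.trans ?_
  unfold r₁ r₂ r₃
  ring

theorem Ωy_eq (h : NoCollision m₁ m₂ m₃ x y) :
    Ωy m₁ m₂ m₃ x y = y - m₁ / r₁ m₁ m₂ m₃ x y ^ 3 * (y - y₁ m₁ m₂ m₃) -
      m₂ / r₂ m₁ m₂ m₃ x y ^ 3 * (y - y₂ m₁ m₂ m₃) -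
      m₃ / r₃ m₁ m₂ m₃ x y ^ 3 * (y - y₃ m₁ m₂ m₃) := by
  have h0 : HasDerivAt (fun s : ℝ => 1 / 2 * (x ^ 2 + s ^ 2)) y y := by
    refine ((((hasDerivAt_id y).pow 2).const_add (x ^ 2)).const_mul (1 / 2 : ℝ)).congr_deriv ?_
    simp
  refine (((h0.add h.1.hasDerivAt_potential_snd).add h.2.1.hasDerivAt_potential_snd).add
    h.2.2.hasDerivAt_potential_snd).deriv.trans ?_
  unfold r₁ r₂ r₃
  ring

theorem NoCollision.eventually_fst (h : NoCollision m₁ m₂ m₃ x y) :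
    ∀ᶠ s in 𝓝 x, NoCollision m₁ m₂ m₃ s y :=
  (Continuous.prodMk_left y).continuousAt.eventually h.eventually

theorem NoCollision.eventually_snd (h : NoCollision m₁ m₂ m₃ x y) :
    ∀ᶠ s in 𝓝 y, NoCollision m₁ m₂ m₃ x s :=
  (Continuous.prodMk_right x).continuousAt.eventually h.eventually

theorem Ωxx_eq (h : NoCollision m₁ m₂ m₃ x y) :
    Ωxx m₁ m₂ m₃ x y = 1 -
      (m₁ / r₁ m₁ m₂ m₃ x y ^ 3 + m₂ / r₂ m₁ m₂ m₃ x y ^ 3 + m₃ / r₃ m₁ m₂ m₃ x y ^ 3) +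
      3 * (m₁ / r₁ m₁ m₂ m₃ x y ^ 5 * (x - x₁ m₁ m₂ m₃) ^ 2 +
        m₂ / r₂ m₁ m₂ m₃ x y ^ 5 * (x - x₂ m₁ m₂ m₃) ^ 2 +
        m₃ / r₃ m₁ m₂ m₃ x y ^ 5 * (x - x₃ m₁ m₂ m₃) ^ 2) := by
  refine (Filter.EventuallyEq.deriv_eq (h.eventually_fst.mono fun s hs => Ωx_eq hs)).trans ?_
  refine ((((hasDerivAt_id x).sub h.1.hasDerivAt_force_fst_fst).sub
    h.2.1.hasDerivAt_force_fst_fst).sub h.2.2.hasDerivAt_force_fst_fst).deriv.trans ?_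
  unfold r₁ r₂ r₃
  ring

theorem Ωxy_eq (h : NoCollision m₁ m₂ m₃ x y) :
    Ωxy m₁ m₂ m₃ x y =
      3 * (m₁ / r₁ m₁ m₂ m₃ x y ^ 5 * (x - x₁ m₁ m₂ m₃) * (y - y₁ m₁ m₂ m₃) +
        m₂ / r₂ m₁ m₂ m₃ x y ^ 5 * (x - x₂ m₁ m₂ m₃) * (y - y₂ m₁ m₂ m₃) +
        m₃ / r₃ m₁ m₂ m₃ x y ^ 5 * (x - x₃ m₁ m₂ m₃) * (y - y₃ m₁ m₂ m₃)) := by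
  refine (Filter.EventuallyEq.deriv_eq (h.eventually_snd.mono fun s hs => Ωx_eq hs)).trans ?_
  refine ((((hasDerivAt_const y x).sub h.1.hasDerivAt_force_fst_snd).sub
    h.2.1.hasDerivAt_force_fst_snd).sub h.2.2.hasDerivAt_force_fst_snd).deriv.trans ?_
  unfold r₁ r₂ r₃
  ring

/-- The mixed second derivatives agree. -/
theorem deriv_Ωy_fst (h : NoCollision m₁ m₂ m₃ x y) :
    deriv (fun s => Ωy m₁ m₂ m₃ s y) x = Ωxy m₁ m₂ m₃ x y := by
  rw [Ωxy_eq h]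
  refine (Filter.EventuallyEq.deriv_eq (h.eventually_fst.mono fun s hs => Ωy_eq hs)).trans ?_
  refine ((((hasDerivAt_const x y).sub h.1.hasDerivAt_force_snd_fst).sub
    h.2.1.hasDerivAt_force_snd_fst).sub h.2.2.hasDerivAt_force_snd_fst).deriv.trans ?_
  unfold r₁ r₂ r₃
  ring

theorem Ωyy_eq (h : NoCollision m₁ m₂ m₃ x y) :
    Ωyy m₁ m₂ m₃ x y = 1 -
      (m₁ / r₁ m₁ m₂ m₃ x y ^ 3 + m₂ / r₂ m₁ m₂ m₃ x y ^ 3 + m₃ / r₃ m₁ m₂ m₃ x y ^ 3) +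
      3 * (m₁ / r₁ m₁ m₂ m₃ x y ^ 5 * (y - y₁ m₁ m₂ m₃) ^ 2 +
        m₂ / r₂ m₁ m₂ m₃ x y ^ 5 * (y - y₂ m₁ m₂ m₃) ^ 2 +
        m₃ / r₃ m₁ m₂ m₃ x y ^ 5 * (y - y₃ m₁ m₂ m₃) ^ 2) := by
  refine (Filter.EventuallyEq.deriv_eq (h.eventually_snd.mono fun s hs => Ωy_eq hs)).trans ?_
  refine ((((hasDerivAt_id y).sub h.1.hasDerivAt_force_snd_snd).sub
    h.2.1.hasDerivAt_force_snd_snd).sub h.2.2.hasDerivAt_force_snd_snd).deriv.trans ?_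
  unfold r₁ r₂ r₃
  ring

theorem differentiableAt_Ωx (h : NoCollision m₁ m₂ m₃ x y) :
    DifferentiableAt ℝ (fun p : ℝ × ℝ => Ωx m₁ m₂ m₃ p.1 p.2) (x, y) := by
  refine DifferentiableAt.congr_of_eventuallyEq ?_ (h.eventually.mono fun p hp => Ωx_eq hp)
  exact ((differentiableAt_fst.sub (h.1.differentiableAt_inv_cube.mul
    (differentiableAt_fst.sub_const _))).sub (h.2.1.differentiableAt_inv_cube.mul
    (differentiableAt_fst.sub_const _))).sub (h.2.2.differentiableAt_inv_cube.mul
    (differentiableAt_fst.sub_const _))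

theorem differentiableAt_Ωy (h : NoCollision m₁ m₂ m₃ x y) :
    DifferentiableAt ℝ (fun p : ℝ × ℝ => Ωy m₁ m₂ m₃ p.1 p.2) (x, y) := by
  refine DifferentiableAt.congr_of_eventuallyEq ?_ (h.eventually.mono fun p hp => Ωy_eq hp)
  exact ((differentiableAt_snd.sub (h.1.differentiableAt_inv_cube.mul
    (differentiableAt_snd.sub_const _))).sub (h.2.1.differentiableAt_inv_cube.mul
    (differentiableAt_snd.sub_const _))).sub (h.2.2.differentiableAt_inv_cube.mul
    (differentiableAt_snd.sub_const _))

theorem fderiv_prod_apply {ψ : ℝ → ℝ → ℝ} {x y : ℝ}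
    (h : DifferentiableAt ℝ (fun p : ℝ × ℝ => ψ p.1 p.2) (x, y)) (u v : ℝ) :
    fderiv ℝ (fun p : ℝ × ℝ => ψ p.1 p.2) (x, y) (u, v) =
      u * deriv (fun s => ψ s y) x + v * deriv (fun s => ψ x s) y := by
  have hx : HasDerivAt (fun s => ψ s y) (fderiv ℝ (fun p : ℝ × ℝ => ψ p.1 p.2) (x, y) (1, 0)) x :=
    HasFDerivAt.comp_hasDerivAt (f := fun s => (s, y)) x h.hasFDerivAt
      ((hasDerivAt_id x).prodMk (hasDerivAt_const x y))
  have hy : HasDerivAt (fun s => ψ x s) (fderiv ℝ (fun p : ℝ × ℝ => ψ p.1 p.2) (x, y) (0, 1)) y :=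
    HasFDerivAt.comp_hasDerivAt (f := fun s => (x, s)) y h.hasFDerivAt
      ((hasDerivAt_const y x).prodMk (hasDerivAt_id y))
  rw [hx.deriv, hy.deriv, show ((u, v) : ℝ × ℝ) = u • (1, 0) + v • (0, 1) by simp, map_add,
    map_smul, map_smul, smul_eq_mul, smul_eq_mul]

theorem hasFDerivAt_comp_coords {ψ : ℝ → ℝ → ℝ} {L : Fin 4 → ℝ}
    (h : DifferentiableAt ℝ (fun p : ℝ × ℝ => ψ p.1 p.2) (L 0, L 2)) :
    HasFDerivAt (fun u : Fin 4 → ℝ => ψ (u 0) (u 2))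
      (deriv (fun s => ψ s (L 2)) (L 0) •
          ContinuousLinearMap.proj (R := ℝ) (φ := fun _ : Fin 4 => ℝ) 0 +
        deriv (fun s => ψ (L 0) s) (L 2) •
          ContinuousLinearMap.proj (R := ℝ) (φ := fun _ : Fin 4 => ℝ) 2) L := by
  have h02 : HasFDerivAt (fun u : Fin 4 → ℝ => (u 0, u 2))
      ((ContinuousLinearMap.proj (R := ℝ) (φ := fun _ : Fin 4 => ℝ) 0).prod
        (ContinuousLinearMap.proj (R := ℝ) (φ := fun _ : Fin 4 => ℝ) 2)) L :=
    (hasFDerivAt_apply 0 L).prodMk (hasFDerivAt_apply 2 L)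
  refine (h.hasFDerivAt.comp L h02).congr_fderiv ?_
  ext v
  simp [fderiv_prod_apply h, mul_comm]

/-- The Jacobian matrix of the vector field at an equilibrium where the potential has the Hessian
with rows `(a, b)` and `(b, c)`. -/
def linearization (a b c : ℝ) : Matrix (Fin 4) (Fin 4) ℝ :=
  !![0, 1, 0, 0; a, 0, b, 2; 0, 0, 0, 1; b, -2, c, 0]

theorem hasFDerivAt_f {x y : ℝ} (h : NoCollision m₁ m₂ m₃ x y) :
    HasFDerivAt (f m₁ m₂ m₃) (LinearMap.toContinuousLinearMap (Matrix.toLin'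
      (linearization (Ωxx m₁ m₂ m₃ x y) (Ωxy m₁ m₂ m₃ x y) (Ωyy m₁ m₂ m₃ x y))))
      ![x, 0, y, 0] := by
  rw [hasFDerivAt_pi']
  have hx := hasFDerivAt_comp_coords (ψ := Ωx m₁ m₂ m₃) (L := ![x, 0, y, 0])
    (differentiableAt_Ωx h)
  have hy := hasFDerivAt_comp_coords (ψ := Ωy m₁ m₂ m₃) (L := ![x, 0, y, 0])
    (differentiableAt_Ωy h)
  intro i
  fin_cases i
  · refine (hasFDerivAt_apply (𝕜 := ℝ) (1 : Fin 4) ![x, 0, y, 0]).congr_fderiv ?_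
    ext v
    simp [linearization, Matrix.vecHead, Matrix.vecTail]
  · refine (((hasFDerivAt_apply (𝕜 := ℝ) (3 : Fin 4) ![x, 0, y, 0]).const_mul 2).add
      hx).congr_fderiv ?_
    ext v
    simp [linearization, Matrix.vecHead, Matrix.vecTail]
    unfold Ωxx Ωxy
    ring
  · refine (hasFDerivAt_apply (𝕜 := ℝ) (3 : Fin 4) ![x, 0, y, 0]).congr_fderiv ?_
    ext v
    simp [linearization, Matrix.vecHead, Matrix.vecTail]
  · refine (((hasFDerivAt_apply (𝕜 := ℝ) (1 : Fin 4) ![x, 0, y, 0]).const_mul (-2)).add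
      hy).congr_fderiv ?_
    ext v
    simp [linearization, Matrix.vecHead, Matrix.vecTail, deriv_Ωy_fst h]
    unfold Ωyy
    ring

/-! ### Linear algebra of the linearization -/

theorem linearization_charpoly (a b c : ℝ) :
    (Matrix.toLin' (linearization a b c)).charpoly =
      X ^ 4 + C (4 - a - c) * X ^ 2 + C (a * c - b ^ 2) := by
  rw [Matrix.charpoly_toLin', Matrix.charpoly, linearization]
  simp [Matrix.charmatrix, Matrix.det_succ_row_zero, Fin.sum_univ_succ, Fin.succAbove]
  have h4 : (C 4 : ℝ[X]) = C 2 ^ 2 := by rw [← C_pow]; norm_num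
  rw [h4]
  ring

theorem linearization_apply (a b c : ℝ) (v : Fin 4 → ℝ) :
    Matrix.toLin' (linearization a b c) v =
      ![v 1, a * v 0 + b * v 2 + 2 * v 3, v 3, b * v 0 - 2 * v 1 + c * v 2] := by
  ext i
  fin_cases i <;> simp [linearization, Matrix.vecHead, Matrix.vecTail] <;> ring

theorem hasEigenvalue_zero_iff (a b c : ℝ) :
    Module.End.HasEigenvalue (Matrix.toLin' (linearization a b c)) 0 ↔
      a * c = b ^ 2 := by
  rw [Module.End.hasEigenvalue_iff_isRoot_charpoly, linearization_charpoly]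
  simp [sub_eq_zero]

theorem rootMultiplicity_zero {k : ℝ} (hk : k ≠ 0) :
    (X ^ 4 + C k * X ^ 2 + C 0 : ℝ[X]).rootMultiplicity 0 = 2 := by
  have : (X ^ 4 + C k * X ^ 2 + C 0 : ℝ[X]) = (X ^ 2 + C k) * (X - C 0) ^ 2 := by
    simp; ring
  have hne : (X ^ 2 + C k : ℝ[X]) ≠ 0 := by
    intro h
    have := congrArg (eval 0) h
    simp at this
    exact hk this
  rw [this, rootMultiplicity_mul_X_sub_C_pow hne, rootMultiplicity_eq_zero, zero_add]
  simp [hk]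

theorem isUnit_iff_not_hasEigenvalue (φ : Module.End ℝ (Fin 4 → ℝ)) :
    IsUnit φ ↔ ¬ φ.HasEigenvalue 0 := by
  rw [Module.End.hasEigenvalue_iff_mem_spectrum, spectrum.zero_mem_iff, not_not]

theorem finrank_eigenspace_zero {a b c : ℝ} (hdet : a * c = b ^ 2) (h : c ≠ 0 ∨ b ≠ 0) :
    Module.finrank ℝ (Module.End.eigenspace (Matrix.toLin' (linearization a b c)) 0) = 1 := by
  have hmem : ![c, 0, -b, 0] ∈ Module.End.eigenspace (Matrix.toLin' (linearization a b c)) 0 := by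
    rw [Module.End.mem_eigenspace_iff, linearization_apply]
    ext i
    fin_cases i <;> simp <;> linarith
  refine finrank_eq_one_iff'.2 ⟨⟨_, hmem⟩, ?_, ?_⟩
  · intro h0
    have h0' := congrArg Subtype.val h0
    have hc := congrFun h0' 0
    have hb := congrFun h0' 2
    simp at hc hb
    exact h.elim (· hc) (· hb)
  · rintro ⟨w, hw⟩
    rw [Module.End.mem_eigenspace_iff, linearization_apply, zero_smul] at hw
    have w1 := congrFun hw 0
    have w3 := congrFun hw 2
    have e1 := congrFun hw 1
    have e2 := congrFun hw 3
    simp at w1 w3 e1 e2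
    rw [w3] at e1
    rw [w1] at e2
    rcases h with hc | hb
    · refine ⟨w 0 / c, Subtype.ext ?_⟩
      ext i
      fin_cases i <;> simp [w1, w3]
      · field_simp
      · field_simp; linarith
    · refine ⟨- w 2 / b, Subtype.ext ?_⟩
      ext i
      fin_cases i <;> simp [w1, w3]
      · field_simp
        have : b * (b * w 0 + c * w 2) = 0 := by
          rw [show b * w 0 + c * w 2 = 0 by linarith, mul_zero]
        refine mul_left_cancel₀ hb ?_
        linarith
      · field_simp

/-! ### The triangle of the primaries -/

theorem K_pos (hm : InSimplex m₁ m₂ m₃) (hK : K m₁ m₂ m₃ ≠ 0) : 0 < K m₁ m₂ m₃ := by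
  obtain ⟨-, h3, h32, h21⟩ := hm
  refine lt_of_le_of_ne ?_ hK.symm
  have h1 : K m₁ m₂ m₃ = m₂ * m₃ + m₂ * (m₁ - m₂) + 2 * (m₁ * m₃) := by unfold K; ring
  have : 0 ≤ m₁ - m₂ := by linarith
  have : 0 ≤ m₂ := by linarith
  have : 0 ≤ m₁ := by linarith
  rw [h1]; positivity

theorem m₂_pos (hm : InSimplex m₁ m₂ m₃) (hK : K m₁ m₂ m₃ ≠ 0) : 0 < m₂ := by
  obtain ⟨-, h3, h32, -⟩ := hm
  refine lt_of_le_of_ne (h3.trans h32) fun h => hK ?_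
  have : m₃ = 0 := by linarith
  rw [K, this, ← h]; ring

theorem x₁_eq (hK : 0 < K m₁ m₂ m₃) : x₁ m₁ m₂ m₃ = -√(m₂ ^ 2 + m₂ * m₃ + m₃ ^ 2) := by
  rw [x₁, abs_of_pos hK]; field_simp

theorem x₂_eq (hK : 0 < K m₁ m₂ m₃) : x₂ m₁ m₂ m₃ =
    ((m₂ - m₃) * m₃ + m₁ * (2 * m₂ + m₃)) / (2 * √(m₂ ^ 2 + m₂ * m₃ + m₃ ^ 2)) := by
  rw [x₂, abs_of_pos hK]; field_simp

theorem x₃_eq (hK : 0 < K m₁ m₂ m₃) : x₃ m₁ m₂ m₃ =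
    (m₂ * (m₃ - m₂) + m₁ * (m₂ + 2 * m₃)) / (2 * √(m₂ ^ 2 + m₂ * m₃ + m₃ ^ 2)) := by
  rw [x₃, abs_of_pos hK, K]

theorem y₂_eq (h : 0 < m₂) : y₂ m₁ m₂ m₃ =
    -(√3 / (2 * √(m₂ ^ 2 + m₂ * m₃ + m₃ ^ 2)) * m₃) := by
  have h1 : m₂ ^ (3 / 2 : ℝ) = √(m₂ ^ 3) := by
    rw [Real.sqrt_eq_rpow, ← Real.rpow_natCast, ← Real.rpow_mul h.le]; norm_num
  have h2 : 0 < √(m₂ ^ 3) := Real.sqrt_pos.2 (by positivity)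
  rw [y₂, h1, Real.sqrt_div (by positivity)]
  field_simp

theorem y₃_eq (h : 0 < m₂) : y₃ m₁ m₂ m₃ =
    √3 / (2 * √(m₂ ^ 2 + m₂ * m₃ + m₃ ^ 2)) * m₂ := by
  have h1 : √(m₂ ^ 3) = m₂ * √m₂ := by
    rw [pow_succ, Real.sqrt_mul (by positivity), Real.sqrt_sq h.le]
  have h2 : 0 < √m₂ := Real.sqrt_pos.2 h
  rw [y₃, Real.sqrt_div (by positivity), h1]
  field_simp

/-- The abscissae of the primaries. -/
noncomputable def px (m₁ m₂ m₃ : ℝ) : Fin 3 → ℝ := ![x₁ m₁ m₂ m₃, x₂ m₁ m₂ m₃, x₃ m₁ m₂ m₃]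

/-- The ordinates of the primaries. -/
noncomputable def py (m₁ m₂ m₃ : ℝ) : Fin 3 → ℝ := ![y₁ m₁ m₂ m₃, y₂ m₁ m₂ m₃, y₃ m₁ m₂ m₃]

/-- The primaries form an equilateral triangle of side one. -/
theorem primaries_side (hm : InSimplex m₁ m₂ m₃) (hK : K m₁ m₂ m₃ ≠ 0) (i j : Fin 3)
    (hij : i ≠ j) :
    (px m₁ m₂ m₃ i - px m₁ m₂ m₃ j) ^ 2 + (py m₁ m₂ m₃ i - py m₁ m₂ m₃ j) ^ 2 = 1 := by
  have hK' := K_pos hm hK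
  have h2 := m₂_pos hm hK
  have h3 := hm.2.1
  have hm1 : m₁ = 1 - m₂ - m₃ := by linarith [hm.1]
  obtain ⟨M, hM⟩ : ∃ M, M = √(m₂ ^ 2 + m₂ * m₃ + m₃ ^ 2) := ⟨_, rfl⟩
  have hM2 : M ^ 2 = m₂ ^ 2 + m₂ * m₃ + m₃ ^ 2 := by rw [hM, Real.sq_sqrt (by positivity)]
  have hM0 : 0 < M := by rw [hM]; exact Real.sqrt_pos.2 (by positivity)
  have ht : √3 ^ 2 = (3 : ℝ) := Real.sq_sqrt (by norm_num)
  have s01 : (x₁ m₁ m₂ m₃ - x₂ m₁ m₂ m₃) ^ 2 + (y₁ m₁ m₂ m₃ - y₂ m₁ m₂ m₃) ^ 2 = 1 := by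
    rw [x₁_eq hK', x₂_eq hK', y₁, y₂_eq h2, ← hM]
    have : -M - ((m₂ - m₃) * m₃ + m₁ * (2 * m₂ + m₃)) / (2 * M) = -(2 * m₂ + m₃) / (2 * M) := by
      field_simp
      rw [hM2, hm1]; ring
    rw [this]
    field_simp
    linear_combination m₃ ^ 2 * ht - 4 * hM2
  have s02 : (x₁ m₁ m₂ m₃ - x₃ m₁ m₂ m₃) ^ 2 + (y₁ m₁ m₂ m₃ - y₃ m₁ m₂ m₃) ^ 2 = 1 := by
    rw [x₁_eq hK', x₃_eq hK', y₁, y₃_eq h2, ← hM]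
    have : -M - (m₂ * (m₃ - m₂) + m₁ * (m₂ + 2 * m₃)) / (2 * M) = -(m₂ + 2 * m₃) / (2 * M) := by
      field_simp
      rw [hM2, hm1]; ring
    rw [this]
    field_simp
    linear_combination m₂ ^ 2 * ht - 4 * hM2
  have s12 : (x₂ m₁ m₂ m₃ - x₃ m₁ m₂ m₃) ^ 2 + (y₂ m₁ m₂ m₃ - y₃ m₁ m₂ m₃) ^ 2 = 1 := by
    rw [x₂_eq hK', x₃_eq hK', y₂_eq h2, y₃_eq h2, ← hM]
    have : ((m₂ - m₃) * m₃ + m₁ * (2 * m₂ + m₃)) / (2 * M) -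
        (m₂ * (m₃ - m₂) + m₁ * (m₂ + 2 * m₃)) / (2 * M) = (m₂ - m₃) / (2 * M) := by
      rw [hm1]; field_simp; ring
    rw [this]
    field_simp
    linear_combination (m₂ + m₃) ^ 2 * ht - 4 * hM2
  fin_cases i <;> fin_cases j <;> first
    | exact absurd rfl hij
    | simpa [px, py] using s01
    | simpa [px, py] using s02
    | simpa [px, py] using s12
    | simpa [px, py, sub_sq_comm] using s01
    | simpa [px, py, sub_sq_comm] using s02
    | simpa [px, py, sub_sq_comm] using s12

theorem centerOfMass_x (hm : InSimplex m₁ m₂ m₃) (hK : K m₁ m₂ m₃ ≠ 0) :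
    m₁ * x₁ m₁ m₂ m₃ + m₂ * x₂ m₁ m₂ m₃ + m₃ * x₃ m₁ m₂ m₃ = 0 := by
  have hK' := K_pos hm hK
  have h2 := m₂_pos hm hK
  have h3 := hm.2.1
  obtain ⟨M, hM⟩ : ∃ M, M = √(m₂ ^ 2 + m₂ * m₃ + m₃ ^ 2) := ⟨_, rfl⟩
  have hM2 : M ^ 2 = m₂ ^ 2 + m₂ * m₃ + m₃ ^ 2 := by rw [hM, Real.sq_sqrt (by positivity)]
  have hM0 : 0 < M := by rw [hM]; exact Real.sqrt_pos.2 (by positivity)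
  rw [x₁_eq hK', x₂_eq hK', x₃_eq hK', ← hM]
  field_simp
  rw [hM2]; ring

theorem centerOfMass_y (hm : InSimplex m₁ m₂ m₃) (hK : K m₁ m₂ m₃ ≠ 0) :
    m₁ * y₁ m₁ m₂ m₃ + m₂ * y₂ m₁ m₂ m₃ + m₃ * y₃ m₁ m₂ m₃ = 0 := by
  have h2 := m₂_pos hm hK
  rw [y₁, y₂_eq h2, y₃_eq h2]; ring

/-! ### Critical libration points -/

/-- At a critical libration point, `s - 1` is positive and rescaling by it produces a degenerate
configuration. -/
theorem critical_config (hm : InSimplex m₁ m₂ m₃) (hK : K m₁ m₂ m₃ ≠ 0)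
    (h : NoCollision m₁ m₂ m₃ x y) (hx : Ωx m₁ m₂ m₃ x y = 0) (hy : Ωy m₁ m₂ m₃ x y = 0)
    {e₁ e₂ s : ℝ} (he : e₁ ≠ 0 ∨ e₂ ≠ 0)
    (hn₁ : Ωxx m₁ m₂ m₃ x y * e₁ + Ωxy m₁ m₂ m₃ x y * e₂ = 0)
    (hn₂ : Ωxy m₁ m₂ m₃ x y * e₁ + Ωyy m₁ m₂ m₃ x y * e₂ = 0)
    (hs : s = m₁ / r₁ m₁ m₂ m₃ x y ^ 3 + m₂ / r₂ m₁ m₂ m₃ x y ^ 3 + m₃ / r₃ m₁ m₂ m₃ x y ^ 3) :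
    let m : Fin 3 → ℝ := ![m₁, m₂, m₃]
    let r : Fin 3 → ℝ := ![r₁ m₁ m₂ m₃ x y, r₂ m₁ m₂ m₃ x y, r₃ m₁ m₂ m₃ x y]
    1 < s ∧ DegenerateConfig (fun i => x - px m₁ m₂ m₃ i) (fun i => y - py m₁ m₂ m₃ i)
      (fun i => m i / r i ^ 3 / (s - 1) * (1 - r i ^ 3)) (fun i => m i / r i ^ 3 / (s - 1)) r
      e₁ e₂ := by
  intro m r
  have h2 := m₂_pos hm hK
  have h3 := hm.2.1
  have h1 : 0 < m₁ := by linarith [hm.2.2.2]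
  have hr : ∀ i, r i = dist2 (px m₁ m₂ m₃ i) (py m₁ m₂ m₃ i) x y := by
    intro i; fin_cases i <;> rfl
  refine degenerateConfig_of_null (m := m) (r := r) ?_ ?_ h1 h2 ?_ ?_ ?_ ?_ ?_ ?_ ?_ he ?_ ?_
  · intro i; fin_cases i <;> simp [m, h1.le, h2.le, h3]
  · simpa [Fin.sum_univ_three, m] using hm.1
  · intro i j hij
    have := primaries_side hm hK i j hij
    linarith
  · intro i; rw [hr]; exact dist2_nonneg _ _ _ _
  · intro i; rw [hr]; exact dist2_sq _ _ _ _
  · intro i hmi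
    rw [hr]
    refine (dist2_pos ?_).ne'
    fin_cases i
    · exact h.1 hmi
    · exact h.2.1 hmi
    · exact h.2.2 hmi
  · rw [hs, Fin.sum_univ_three]; rfl
  · rw [Ωx_eq h] at hx
    have := centerOfMass_x hm hK
    simp only [Fin.sum_univ_three, m, r, px, Matrix.cons_val]
    linear_combination this - hx - x * hm.1
  · rw [Ωy_eq h] at hy
    have := centerOfMass_y hm hK
    simp only [Fin.sum_univ_three, m, r, py, Matrix.cons_val]
    linear_combination this - hy - y * hm.1
  · rw [Ωxx_eq h, Ωxy_eq h, ← hs] at hn₁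
    simp only [Fin.sum_univ_three, m, r, px, py, Matrix.cons_val]
    linear_combination hn₁
  · rw [Ωyy_eq h, Ωxy_eq h, ← hs] at hn₂
    simp only [Fin.sum_univ_three, m, r, px, py, Matrix.cons_val]
    linear_combination hn₂

theorem laplacian_eq (h : NoCollision m₁ m₂ m₃ x y) :
    Ωxx m₁ m₂ m₃ x y + Ωyy m₁ m₂ m₃ x y = 2 +
      (m₁ / r₁ m₁ m₂ m₃ x y ^ 3 + m₂ / r₂ m₁ m₂ m₃ x y ^ 3 + m₃ / r₃ m₁ m₂ m₃ x y ^ 3) := by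
  have key : ∀ {m a b : ℝ}, Regular m a b x y → m / dist2 a b x y ^ 5 * (x - a) ^ 2 +
      m / dist2 a b x y ^ 5 * (y - b) ^ 2 = m / dist2 a b x y ^ 3 := by
    intro m a b hr
    by_cases hm : m = 0
    · simp [hm]
    have := (dist2_pos (hr hm)).ne'
    rw [← mul_add, ← dist2_sq]
    field_simp
  have k1 := key h.1
  have k2 := key h.2.1
  have k3 := key h.2.2
  rw [Ωxx_eq h, Ωyy_eq h]
  unfold r₁ r₂ r₃
  linarith

/-- At a critical libration point the coefficient of `λ ^ 2` in the characteristic polynomial is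
negative. -/
theorem four_lt_laplacian (hm : InSimplex m₁ m₂ m₃) (hK : K m₁ m₂ m₃ ≠ 0)
    (h : NoCollision m₁ m₂ m₃ x y) (hx : Ωx m₁ m₂ m₃ x y = 0) (hy : Ωy m₁ m₂ m₃ x y = 0)
    (hdet : Ωxx m₁ m₂ m₃ x y * Ωyy m₁ m₂ m₃ x y = Ωxy m₁ m₂ m₃ x y ^ 2) :
    4 < Ωxx m₁ m₂ m₃ x y + Ωyy m₁ m₂ m₃ x y := by
  -- The columns of the adjugate of a singular matrix are null vectors.
  have hnull : ∃ e₁ e₂ : ℝ, (e₁ ≠ 0 ∨ e₂ ≠ 0) ∧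
      Ωxx m₁ m₂ m₃ x y * e₁ + Ωxy m₁ m₂ m₃ x y * e₂ = 0 ∧
      Ωxy m₁ m₂ m₃ x y * e₁ + Ωyy m₁ m₂ m₃ x y * e₂ = 0 := by
    by_cases h0 : Ωyy m₁ m₂ m₃ x y = 0
    · refine ⟨0, 1, .inr one_ne_zero, ?_, by simp [h0]⟩
      rw [h0, mul_zero] at hdet
      simp [pow_eq_zero_iff two_ne_zero |>.1 hdet.symm]
    · exact ⟨Ωyy m₁ m₂ m₃ x y, -Ωxy m₁ m₂ m₃ x y, .inl h0, by linear_combination hdet, by ring⟩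
  obtain ⟨e₁, e₂, he, hn₁, hn₂⟩ := hnull
  obtain ⟨hs, hD⟩ := critical_config hm hK h hx hy he hn₁ hn₂ rfl
  rw [laplacian_eq h]
  have := hD.sum_T_lt_two
  rw [← Finset.sum_div, div_lt_iff₀ (by linarith)] at this
  simp only [Fin.sum_univ_three, Matrix.cons_val] at this
  linarith

/-- The vector `v₀` does not vanish: otherwise `(0, 1)` would be a null vector of the Hessian. -/
theorem Ωyy_ne_zero_or_Ωxy_ne_zero (hm : InSimplex m₁ m₂ m₃) (hK : K m₁ m₂ m₃ ≠ 0)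
    (h : NoCollision m₁ m₂ m₃ x y) (hx : Ωx m₁ m₂ m₃ x y = 0) (hy : Ωy m₁ m₂ m₃ x y = 0) :
    Ωyy m₁ m₂ m₃ x y ≠ 0 ∨ Ωxy m₁ m₂ m₃ x y ≠ 0 := by
  by_contra! h0
  obtain ⟨hs, hD⟩ := critical_config hm hK h hx hy (e₁ := 0) (e₂ := 1) (.inr one_ne_zero)
    (by simp [h0.2]) (by simp [h0.1]) rfl
  have h2 := m₂_pos hm hK
  have h3 := hm.2.1
  have hM2 : 0 < m₂ ^ 2 + m₂ * m₃ + m₃ ^ 2 := by positivity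
  set s := m₁ / r₁ m₁ m₂ m₃ x y ^ 3 + m₂ / r₂ m₁ m₂ m₃ x y ^ 3 + m₃ / r₃ m₁ m₂ m₃ x y ^ 3
  have hμ : 0 < s - 1 := by linarith
  have hmass : ∀ i, (![m₁, m₂, m₃] : Fin 3 → ℝ) i /
      (![r₁ m₁ m₂ m₃ x y, r₂ m₁ m₂ m₃ x y, r₃ m₁ m₂ m₃ x y] : Fin 3 → ℝ) i ^ 3 / (s - 1) *
      (![r₁ m₁ m₂ m₃ x y, r₂ m₁ m₂ m₃ x y, r₃ m₁ m₂ m₃ x y] : Fin 3 → ℝ) i ^ 3 =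
      (![m₁, m₂, m₃] : Fin 3 → ℝ) i / (s - 1) := fun i => by
    have := (hD.r_pos i).ne'
    field_simp
  refine hD.not_null_vertical (m₂ := m₂) (m₃ := m₃)
    (c := √3 / (2 * √(m₂ ^ 2 + m₂ * m₃ + m₃ ^ 2))) h3 hm.2.2.1 ?_ ?_ ?_ ?_ ?_
  · rw [div_pow, mul_pow, Real.sq_sqrt hM2.le, Real.sq_sqrt (by norm_num)]
    field_simp
    norm_num
  · simp [py, y₁, y₂_eq h2]
  · simp [py, y₁, y₃_eq h2]
  · rw [hmass, hmass]
    exact div_le_div_of_nonneg_right (by simpa using hm.2.2.1.trans hm.2.2.2) hμ.le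
  · rw [hmass, hmass]
    exact div_le_div_of_nonneg_right (by simpa using hm.2.2.1) hμ.le

end CRFBP

theorem proposition1 (m₁ m₂ m₃ : ℝ) (hm : CRFBP.InSimplex m₁ m₂ m₃)
    (hK : CRFBP.K m₁ m₂ m₃ ≠ 0) (x₀ y₀ : ℝ)
    (hL : CRFBP.IsLibrationPoint m₁ m₂ m₃ ![x₀, 0, y₀, 0]) :
    DifferentiableAt ℝ (CRFBP.f m₁ m₂ m₃) ![x₀, 0, y₀, 0] ∧
    (CRFBP.Df m₁ m₂ m₃ ![x₀, 0, y₀, 0]).charpoly =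
      X ^ 4 + C (4 - CRFBP.Ωxx m₁ m₂ m₃ x₀ y₀ - CRFBP.Ωyy m₁ m₂ m₃ x₀ y₀) * X ^ 2 +
        C (CRFBP.Ωxx m₁ m₂ m₃ x₀ y₀ * CRFBP.Ωyy m₁ m₂ m₃ x₀ y₀ -
          CRFBP.Ωxy m₁ m₂ m₃ x₀ y₀ ^ 2) ∧
    ((CRFBP.Df m₁ m₂ m₃ ![x₀, 0, y₀, 0]).HasEigenvalue 0 ↔
      CRFBP.Ωxx m₁ m₂ m₃ x₀ y₀ * CRFBP.Ωyy m₁ m₂ m₃ x₀ y₀ =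
        CRFBP.Ωxy m₁ m₂ m₃ x₀ y₀ ^ 2) ∧
    (CRFBP.IsCriticalLibrationPoint m₁ m₂ m₃ ![x₀, 0, y₀, 0] →
      (CRFBP.Df m₁ m₂ m₃ ![x₀, 0, y₀, 0]).charpoly.rootMultiplicity 0 = 2 ∧
      Module.finrank ℝ ((CRFBP.Df m₁ m₂ m₃ ![x₀, 0, y₀, 0]).eigenspace 0) = 1 ∧
      (CRFBP.Df m₁ m₂ m₃ ![x₀, 0, y₀, 0]).HasEigenvector 0 (CRFBP.v₀ m₁ m₂ m₃ x₀ y₀) ∧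
      CRFBP.Df m₁ m₂ m₃ ![x₀, 0, y₀, 0] (CRFBP.v₁ m₁ m₂ m₃ x₀ y₀) =
        CRFBP.v₀ m₁ m₂ m₃ x₀ y₀) := by
  obtain ⟨c1, c2, c3, hf⟩ := hL
  have hreg : CRFBP.NoCollision m₁ m₂ m₃ x₀ y₀ := ⟨c1, c2, c3⟩
  have hx : CRFBP.Ωx m₁ m₂ m₃ x₀ y₀ = 0 := by simpa [CRFBP.f] using congrFun hf 1
  have hy : CRFBP.Ωy m₁ m₂ m₃ x₀ y₀ = 0 := by simpa [CRFBP.f] using congrFun hf 3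
  have hDf : CRFBP.Df m₁ m₂ m₃ ![x₀, 0, y₀, 0] = Matrix.toLin' (CRFBP.linearization
      (CRFBP.Ωxx m₁ m₂ m₃ x₀ y₀) (CRFBP.Ωxy m₁ m₂ m₃ x₀ y₀) (CRFBP.Ωyy m₁ m₂ m₃ x₀ y₀)) := by
    rw [CRFBP.Df, (CRFBP.hasFDerivAt_f hreg).fderiv]
    rfl
  refine ⟨(CRFBP.hasFDerivAt_f hreg).differentiableAt, ?_, ?_, ?_⟩
  · rw [hDf, CRFBP.linearization_charpoly]
  · rw [hDf, CRFBP.hasEigenvalue_zero_iff]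
  rintro ⟨-, hcrit⟩
  rw [CRFBP.isUnit_iff_not_hasEigenvalue, not_not, hDf, CRFBP.hasEigenvalue_zero_iff] at hcrit
  have htr := CRFBP.four_lt_laplacian hm hK hreg hx hy hcrit
  have hv := CRFBP.Ωyy_ne_zero_or_Ωxy_ne_zero hm hK hreg hx hy
  rw [hDf]
  refine ⟨?_, CRFBP.finrank_eigenspace_zero hcrit hv, ⟨?_, ?_⟩, ?_⟩
  · rw [CRFBP.linearization_charpoly, sub_eq_zero.2 hcrit]
    exact CRFBP.rootMultiplicity_zero (by linarith)
  · rw [Module.End.mem_eigenspace_iff, CRFBP.linearization_apply]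
    ext i
    fin_cases i <;> simp [CRFBP.v₀] <;> linarith
  · intro h0
    have h1 := congrFun h0 0
    have h2 := congrFun h0 2
    simp [CRFBP.v₀] at h1 h2
    exact hv.elim (· h1) (· h2)
  · rw [CRFBP.linearization_apply]
    ext i
    fin_cases i <;> simp [CRFBP.v₀, CRFBP.v₁] <;> linarith
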